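/- Let $S=\{a,b,c,d,a^{-1},b^{-1},c^{-1},d^{-1}\}$ and let $\Gamma'$ be the group with generators $a,b,c,d$ and relations $$a^{-1}ba=b^{2},\qquad b^{-2}cb^{2}=c^{2},\qquad c^{-3}dc^{3}=d^{2},\qquad d^{-4}ad^{4}=a^{2}.$$ Let $G$ be its Cayley graph: the simple undirected graph with vertex set $\Gamma'$ in which distinct $\gamma_1,\gamma_2$ are adjacent if and only if $\gamma_2=\gamma_1s$ for some $s\in S$. Let $\mathrm{Aut}(G)$ be its automorphism group. A *graph height function* on $G$ is a pair $(h,\mathcal H)$, where $h:\Gamma'\to\mathbb Z$ and $\mathcal H\le\mathrm{Aut}(G)$ is a subgroup acting quasi-transitively on $G$ (there is a finite set $W$ of vertices such that every vertex is mapped into $W$ by some element of $\mathcal H$), such that (a) $h(1)=0$; (b) $h(v)-h(w)=h(\gamma v)-h(\gamma w)$ for all vertices $v,w$ and all $\gamma\in\mathcal H$; (c) every vertex $v$ has neighbours $u,w$ with $h(u)<h(v)<h(w)$. A *group height function* on $\Gamma'$ is a function $h:\Gamma'\to\mathbb Z$, not identically zero, with $h(1)=0$, such that $h(s_1\cdots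 s_m)=\sum_{i=1}^m h(s_i)$ for all $s_1,\dots,s_m\in S$, and $\sum_{i=1}^n h(s_i)=0$ whenever $s_i\in S$ and $s_1\cdots s_n=1$. **Theorem.** The Cayley graph $G$ has no graph height function. Moreover, $\Gamma'$ has no group height function; for every vertex $v$ of $G$, the stabiliser $\{\eta\in\mathrm{Aut}(G):\eta(v)=v\}$ is trivial; and $\Gamma'$ has no proper normal subgroup of finite index. -/

import Mathlib

namespace HigmanType

/-! ### Height functions on graphs and groups -/

section Graphs

variable {V : Type*} (G : SimpleGraph V)

/-- A subgroup `H` of `Aut(G)` acts quasi-transitively on `G`: there is a finite set `W` of vertices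
such that every vertex is carried into `W` by some element of `H`. -/
def ActsQuasiTransitively (H : Subgroup (G ≃g G)) : Prop :=
  ∃ W : Set V, W.Finite ∧ ∀ v : V, ∃ α ∈ H, ∃ w ∈ W, α v = w

/-- `F` is `H`-difference-invariant. -/
def IsDifferenceInvariant (H : Subgroup (G ≃g G)) (F : V → ℤ) : Prop :=
  ∀ v w : V, ∀ γ ∈ H, F v - F w = F (γ v) - F (γ w)

/-- The pair `(h, H)` is a graph height function on the graph `G` with origin `o`. -/
structure IsGraphHeightFunction (o : V) (h : V → ℤ) (H : Subgroup (G ≃g G)) : Prop where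
  quasiTransitive : ActsQuasiTransitively G H
  map_origin : h o = 0
  differenceInvariant : IsDifferenceInvariant G H h
  exists_lt_lt : ∀ v : V, ∃ u w : V, G.Adj v u ∧ G.Adj v w ∧ h u < h v ∧ h v < h w

/-- The stabilizer of the vertex `v` in the full automorphism group of `G`. -/
def vertexStabilizer (v : V) : Subgroup (G ≃g G) where
  carrier := {η | η v = v}
  one_mem' := rfl
  mul_mem' {η θ} hη hθ := by
    change η (θ v) = v
    rw [show θ v = v from hθ, show η v = v from hη]
  inv_mem' {η} hη := by
    change η.symm v = v
    rw [RelIso.symm_apply_eq]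
    exact (show η v = v from hη).symm

end Graphs

/-- `h` is a group height function on the group `Γ` with symmetric generating set `S`. -/
structure IsGroupHeightFunction {Γ : Type*} [Group Γ] (S : Set Γ) (h : Γ → ℤ) : Prop where
  map_one : h 1 = 0
  not_identically_zero : ∃ γ : Γ, h γ ≠ 0
  map_word : ∀ l : List Γ, (∀ s ∈ l, s ∈ S) → h l.prod = (l.map h).sum
  sum_eq_zero : ∀ l : List Γ, (∀ s ∈ l, s ∈ S) → l.prod = 1 → (l.map h).sum = 0

/-! ### The group of Higman type -/

/-- The four letters `a, b, c, d`. -/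
inductive Letter : Type
  | a | b | c | d

/-- The relators of the relations
`a⁻¹ b a = b²`, `b⁻² c b² = c²`, `c⁻³ d c³ = d²`, `d⁻⁴ a d⁴ = a²`, in the free group on the
letters; the relation `u = v` has the relator `u v⁻¹`. -/
def relators : Set (FreeGroup Letter) :=
  let a := FreeGroup.of Letter.a
  let b := FreeGroup.of Letter.b
  let c := FreeGroup.of Letter.c
  let d := FreeGroup.of Letter.d
  {(a⁻¹ * b * a) * (b ^ 2)⁻¹,
   ((b ^ 2)⁻¹ * c * b ^ 2) * (c ^ 2)⁻¹,
   ((c ^ 3)⁻¹ * d * c ^ 3) * (d ^ 2)⁻¹,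
   ((d ^ 4)⁻¹ * a * d ^ 4) * (a ^ 2)⁻¹}

/-- The group `Γ'` with generators `a, b, c, d` and the above relations. -/
abbrev Group' : Type := PresentedGroup relators

/-- The symmetric generating set `{a, b, c, d, a⁻¹, b⁻¹, c⁻¹, d⁻¹}` of `Γ'`. -/
def generators : Set Group' :=
  {s | ∃ x : Letter, s = PresentedGroup.of x ∨ s = (PresentedGroup.of x)⁻¹}

/-- The (simple, undirected) Cayley graph of `Γ'`: distinct `γ₁, γ₂` are adjacent if and only if
`γ₂ = γ₁ s` for some `s` in the symmetric generating set. -/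
abbrev cayleyGraph : SimpleGraph Group' := SimpleGraph.mulCayley generators

end HigmanType

/-!
`Γ'` embeds in the amalgam of two chains `⟨a, b, c⟩` and `⟨c, d, a⟩` over the free group `⟨a, c⟩`,
where a chain is an amalgam of two groups `⟨x, y | x⁻ᵏ y xᵏ = y²⟩` over an infinite cyclic group.
Normal forms in these amalgams, together with the affine action of the factors in which `x` is the
multiplication by `2 ^ (-1 / k)` and `y` the translation by `1`, describe short closed walks in the
Cayley graph: those of length five without backtracking use only the letters `a` and `b`, and never
two consecutive `a`. A graph automorphism permutes these walks, so it preserves first the letters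
`b` and `a`, then `c` by means of the relator of length seven, and then `d`. The four relators
finally fix the orientations, so that every automorphism is a left multiplication.

If `p` is the smallest prime that divides the order of the image of a generator in a finite
quotient, then the order of `2` modulo `p` divides the order of the image of the preceding
generator, which gives a smaller prime. Hence `Γ'` has no proper subgroup of finite index, every
subgroup that acts quasi-transitively contains all left multiplications, and a graph height
function is a homomorphism to `ℤ`. The relations abelianize to `b = c = d = a = 1`, so it vanishes.
-/

namespace HigmanType

open Monoid
open FreeGroup (IsReduced)

/-! ### Amalgamated products -/

section Amalgam

variable {ι H : Type*} {G : ι → Type*} [∀ i, Group (G i)] [Group H] {φ : ∀ i, H →* G i}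

theorem of_mem_base_range_iff (hφ : ∀ i, Function.Injective (φ i)) {i : ι} {g : G i} :
    PushoutI.of (φ := φ) i g ∈ (PushoutI.base φ).range ↔ g ∈ (φ i).range := by
  constructor
  · rintro ⟨h, hh⟩
    rw [← PushoutI.of_apply_eq_base φ i] at hh
    exact ⟨h, PushoutI.of_injective hφ i hh⟩
  · rintro ⟨h, rfl⟩
    exact ⟨h, (PushoutI.of_apply_eq_base φ i h).symm⟩

theorem base_range_le_of_range (i : ι) :
    (PushoutI.base φ).range ≤ (PushoutI.of (φ := φ) i).range := by
  rintro _ ⟨h, rfl⟩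
  exact ⟨φ i h, PushoutI.of_apply_eq_base φ i h⟩

theorem eq_empty_of_prod_mem_of_range (hφ : ∀ i, Function.Injective (φ i)) {i : ι}
    {w : CoprodI.Word G} (hw : PushoutI.Reduced φ w) (hi : w.fstIdx ≠ some i)
    (h : PushoutI.ofCoprodI w.prod ∈ (PushoutI.of (φ := φ) i).range) : w = .empty := by
  obtain ⟨g, hg⟩ := h
  by_cases hgφ : g ∈ (φ i).range
  · exact hw.eq_empty_of_mem_range hφ (hg ▸ (of_mem_base_range_iff hφ).2 hgφ)
  have hg1 : g⁻¹ ≠ 1 := fun h => hgφ (inv_eq_one.1 h ▸ one_mem _)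
  have hcons : PushoutI.Reduced φ (.cons g⁻¹ w hi hg1) := by
    simp only [PushoutI.Reduced, CoprodI.Word.cons, List.mem_cons, forall_eq_or_imp, inv_mem_iff]
    exact ⟨hgφ, hw⟩
  have := hcons.eq_empty_of_mem_range hφ (by
    rw [CoprodI.Word.prod_cons, map_mul, PushoutI.ofCoprodI_of, ← hg, map_inv, inv_mul_cancel]
    exact one_mem _)
  simp [CoprodI.Word.cons, CoprodI.Word.empty] at this

theorem mul_mul_notMem_of_range (hφ : ∀ i, Function.Injective (φ i)) {i j : ι} (hij : i ≠ j)
    {p q r : PushoutI φ} (hp : p ∈ (PushoutI.of (φ := φ) j).range)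
    (hp' : p ∉ (PushoutI.of (φ := φ) i).range) (hq : q ∈ (PushoutI.of (φ := φ) i).range)
    (hq' : q ∉ (PushoutI.of (φ := φ) j).range) (hr : r ∈ (PushoutI.of (φ := φ) j).range)
    (hr' : r ∉ (PushoutI.of (φ := φ) i).range) :
    p * q * r ∉ (PushoutI.of (φ := φ) i).range := by
  obtain ⟨p, rfl⟩ := hp
  obtain ⟨q, rfl⟩ := hq
  obtain ⟨r, rfl⟩ := hr
  have notMem {k l : ι} {g : G k} (h : PushoutI.of k g ∉ (PushoutI.of (φ := φ) l).range) :
      g ∉ (φ k).range :=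
    fun hg => h (base_range_le_of_range l ((of_mem_base_range_iff hφ).2 hg))
  have ne_one {k : ι} {g : G k} (h : g ∉ (φ k).range) : g ≠ 1 := fun hg => h (hg ▸ one_mem _)
  let w : CoprodI.Word G :=
    { toList := [⟨j, p⟩, ⟨i, q⟩, ⟨j, r⟩]
      ne_one := by simp [ne_one (notMem hp'), ne_one (notMem hq'), ne_one (notMem hr')]
      chain_ne := by simp [hij, hij.symm] }
  have hw : PushoutI.Reduced φ w := by
    simp only [w, PushoutI.Reduced, List.forall_mem_cons]
    exact ⟨notMem hp', notMem hq', notMem hr', by simp⟩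
  intro h
  have := eq_empty_of_prod_mem_of_range hφ hw (i := i) (by simpa [w, CoprodI.Word.fstIdx] using
    hij.symm) (by simpa [w, CoprodI.Word.prod, PushoutI.ofCoprodI_of, ← mul_assoc] using h)
  simp [w, CoprodI.Word.empty] at this

variable {K : ι → Type*} [∀ i, Group (K i)]

/-- The homomorphism from a free product to an amalgamated product given by homomorphisms of the
factors. -/
def coprodToPushout (φ : ∀ i, H →* G i) (f : ∀ i, K i →* G i) : CoprodI K →* PushoutI φ :=
  CoprodI.lift fun i => (PushoutI.of i).comp (f i)

variable {f : ∀ i, K i →* G i}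

theorem prod_eq_one_of_fstIdx_eq_none {w : CoprodI.Word K} (h : w.fstIdx = none) :
    w.prod = 1 := by
  simp [CoprodI.Word.prod, show w.toList = [] by simpa [CoprodI.Word.fstIdx] using h]

theorem exists_reduced_prod_eq_coprodToPushout (hf : ∀ i x, f i x ∈ (φ i).range → x = 1)
    (w : CoprodI.Word K) :
    ∃ w' : CoprodI.Word G, PushoutI.Reduced φ w' ∧ w'.fstIdx = w.fstIdx ∧
      PushoutI.ofCoprodI w'.prod = coprodToPushout φ f w.prod := by
  have notMem (l) (hl : l ∈ w.toList) : f l.1 l.2 ∉ (φ l.1).range :=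
    fun h => w.ne_one l hl (hf _ _ h)
  let w' : CoprodI.Word G :=
    { toList := w.toList.map fun l => ⟨l.1, f l.1 l.2⟩
      ne_one := by
        simp only [List.mem_map, forall_exists_index, and_imp, forall_apply_eq_imp_iff₂]
        exact fun l hl h => notMem l hl (h ▸ one_mem _)
      chain_ne := by
        rw [List.isChain_map]
        exact w.chain_ne }
  refine ⟨w', ?_, ?_, ?_⟩
  · simpa only [w', PushoutI.Reduced, List.mem_map, forall_exists_index, and_imp,
      forall_apply_eq_imp_iff₂] using notMem
  · simp [w', CoprodI.Word.fstIdx, List.head?_map, Function.comp_def]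
  · simp only [CoprodI.Word.prod, w', map_list_prod, List.map_map]
    refine congrArg List.prod (List.map_congr_left fun l _ => ?_)
    simp [coprodToPushout]

theorem mem_range_of_coprodToPushout_mem (hφ : ∀ i, Function.Injective (φ i))
    (hf : ∀ i x, f i x ∈ (φ i).range → x = 1) {i : ι} {x : CoprodI K}
    (hx : coprodToPushout φ f x ∈ (PushoutI.of (φ := φ) i).range) :
    x ∈ (CoprodI.of (M := K) (i := i)).range := by
  classical
  obtain ⟨w, rfl⟩ := CoprodI.Word.equiv.symm.surjective x
  obtain ⟨p, rfl⟩ := (CoprodI.Word.equivPair i).symm.surjective w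
  change coprodToPushout φ f (CoprodI.Word.rcons p).prod ∈ _ at hx
  change (CoprodI.Word.rcons p).prod ∈ _
  rw [CoprodI.Word.prod_rcons] at hx ⊢
  obtain ⟨w', hred, hfst, hprod⟩ := exists_reduced_prod_eq_coprodToPushout hf p.tail
  have hempty : w' = .empty := by
    refine eq_empty_of_prod_mem_of_range hφ hred (hfst ▸ p.fstIdx_ne) (hprod ▸ ?_)
    rw [map_mul] at hx
    refine (Subgroup.mul_mem_cancel_left _ ?_).1 hx
    exact ⟨f i p.head, by simp [coprodToPushout]⟩
  rw [prod_eq_one_of_fstIdx_eq_none (hfst ▸ hempty ▸ rfl), mul_one]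
  exact ⟨p.head, rfl⟩

theorem coprodToPushout_injective (hφ : ∀ i, Function.Injective (φ i))
    (hf : ∀ i x, f i x ∈ (φ i).range → x = 1) : Function.Injective (coprodToPushout φ f) := by
  classical
  rw [injective_iff_map_eq_one]
  intro x hx
  obtain ⟨w, rfl⟩ := CoprodI.Word.equiv.symm.surjective x
  change coprodToPushout φ f w.prod = 1 at hx
  obtain ⟨w', hred, hfst, hprod⟩ := exists_reduced_prod_eq_coprodToPushout hf w
  have hempty : w' = .empty := hred.eq_empty_of_mem_range hφ (hprod ▸ hx ▸ one_mem _)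
  exact prod_eq_one_of_fstIdx_eq_none (hfst ▸ hempty ▸ rfl)

end Amalgam

/-! ### Baumslag–Solitar type groups -/

/-- The group `⟨x, y | x⁻ᵏ y xᵏ = y²⟩`, with `x` and `y` indexed by `false` and `true`. -/
abbrev BS (k : ℕ) : Type :=
  PresentedGroup {((FreeGroup.of false ^ k)⁻¹ * FreeGroup.of true * FreeGroup.of false ^ k) *
    (FreeGroup.of true ^ 2)⁻¹}

namespace BS

/-- The generator `x`. -/
def x (k : ℕ) : BS k := PresentedGroup.of false

/-- The generator `y`. -/
def y (k : ℕ) : BS k := PresentedGroup.of true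

theorem rel (k : ℕ) : (x k ^ k)⁻¹ * y k * x k ^ k = y k ^ 2 :=
  PresentedGroup.mk_eq_mk_of_mul_inv_mem (Set.mem_singleton _)

variable {k : ℕ} {G : Type*} [Group G]

/-- The homomorphism given by elements that satisfy the relation. -/
def lift (u v : G) (h : (u ^ k)⁻¹ * v * u ^ k = v ^ 2) : BS k →* G :=
  PresentedGroup.toGroup (f := fun i => cond i v u) (by
    rintro r rfl
    simp [h])

@[simp] theorem lift_x (u v : G) (h : (u ^ k)⁻¹ * v * u ^ k = v ^ 2) : lift u v h (x k) = u :=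
  PresentedGroup.toGroup.of _

@[simp] theorem lift_y (u v : G) (h : (u ^ k)⁻¹ * v * u ^ k = v ^ 2) : lift u v h (y k) = v :=
  PresentedGroup.toGroup.of _

theorem hom_ext {f g : BS k →* G} (hx : f (x k) = g (x k)) (hy : f (y k) = g (y k)) : f = g :=
  PresentedGroup.ext fun i => by cases i <;> assumption

/-- The positive real `k`-th root of `1 / 2`. -/
noncomputable def root (k : ℕ) : ℝ := (1 / 2 : ℝ) ^ ((k : ℝ)⁻¹)

theorem root_pos : 0 < root k := by unfold root; positivity

theorem root_pow (hk : k ≠ 0) : root k ^ k = 1 / 2 := Real.rpow_inv_natCast_pow (by norm_num) hk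

theorem root_ne_one (hk : k ≠ 0) : root k ≠ 1 := fun h => by
  have := root_pow hk
  norm_num [h] at this

/-- The affine action on the real line, in which `x` is the multiplication by `root k` and `y` is
the translation by `1`. -/
noncomputable def affine (hk : k ≠ 0) : BS k →* Equiv.Perm ℝ :=
  lift (MulAction.toPermHom ℝˣ ℝ (Units.mk0 (root k) root_pos.ne')) (Equiv.addRight 1) (by
    have h : Units.mk0 (root k) root_pos.ne' ^ k = Units.mk0 (1 / 2 : ℝ) (by norm_num) := by
      ext
      simp [root_pow hk]
    rw [← map_pow, h, mul_assoc, inv_mul_eq_iff_eq_mul]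
    ext t
    simp only [Equiv.Perm.mul_apply, MulAction.toPermHom_apply, MulAction.toPerm_apply,
      Units.smul_def, Units.val_mk0, smul_eq_mul, Equiv.coe_addRight, pow_two]
    ring)

@[simp] theorem affine_x_zpow (hk : k ≠ 0) (n : ℤ) (t : ℝ) :
    (affine hk (x k) ^ n) t = root k ^ n * t := by
  rw [affine, lift_x, ← map_zpow]
  simp [Units.smul_def]

@[simp] theorem affine_y_zpow (hk : k ≠ 0) (n : ℤ) (t : ℝ) : (affine hk (y k) ^ n) t = t + n := by
  rw [affine, lift_y]
  simp

theorem eq_zero_of_x_zpow_eq_y_zpow (hk : k ≠ 0) {m n : ℤ} (h : x k ^ m = y k ^ n) :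
    m = 0 ∧ n = 0 := by
  have at_zero := congrArg (fun g => affine hk g 0) h
  have at_one := congrArg (fun g => affine hk g 1) h
  simp only [map_zpow, affine_x_zpow, affine_y_zpow, mul_zero, zero_add, mul_one] at at_zero at_one
  have hn : n = 0 := by exact_mod_cast at_zero.symm
  refine ⟨?_, hn⟩
  rw [hn, Int.cast_zero, add_zero] at at_one
  by_contra hm
  exact hm ((zpow_eq_one_iff_right₀ root_pos.le (root_ne_one hk)).1 at_one)

theorem x_zpow_eq_one (hk : k ≠ 0) {n : ℤ} (h : x k ^ n = 1) : n = 0 :=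
  (eq_zero_of_x_zpow_eq_y_zpow hk (h.trans (zpow_zero _).symm)).1

theorem y_zpow_eq_one (hk : k ≠ 0) {n : ℤ} (h : y k ^ n = 1) : n = 0 :=
  (eq_zero_of_x_zpow_eq_y_zpow hk ((zpow_zero _).trans h.symm)).2

theorem root_zpow_mul_eq_of_conj (hk : k ≠ 0) {m n m' n' : ℤ}
    (h : x k ^ m * y k ^ n * x k ^ m' = y k ^ n') : root k ^ m * n = n' := by
  simpa using congrArg (fun g => affine hk g 0) h

theorem add_root_zpow_mul_eq_zero (hk : k ≠ 0) {m n m' n' : ℤ}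
    (h : y k ^ n * x k ^ m * y k ^ n' = x k ^ m') : n + root k ^ m * n' = 0 := by
  simpa [add_comm] using congrArg (fun g => affine hk g 0) h

theorem dvd_of_root_zpow_mul_eq (hk : k ≠ 0) {m n n' : ℤ} (hn : n ≠ 0)
    (h : root k ^ m * n = n') : (k : ℤ) ∣ m := by
  have hpow : ((2 : ℚ) ^ (-m)) * (n : ℚ) ^ k = (n' : ℚ) ^ k := by
    have : (root k ^ m) ^ k * (n : ℝ) ^ k = (n' : ℝ) ^ k := by rw [← mul_pow, h]
    rw [← zpow_natCast (root k ^ m), zpow_comm, zpow_natCast, root_pow hk, one_div, inv_zpow,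
      ← zpow_neg] at this
    rw [← Rat.cast_inj (α := ℝ)]
    push_cast
    exact this
  have hval := congrArg (padicValRat 2) hpow
  rw [padicValRat.mul (zpow_ne_zero _ two_ne_zero) (pow_ne_zero _ (Int.cast_ne_zero.2 hn)),
    padicValRat.pow, padicValRat.pow, padicValRat.zpow,
    show padicValRat 2 (2 : ℚ) = 1 from padicValRat.self one_lt_two] at hval
  exact ⟨padicValRat 2 n - padicValRat 2 n', by linarith⟩

theorem eq_zero_of_root_zpow_mul_eq (hk : k ≠ 0) {m n n' : ℤ} (hn : n ≠ 0) (h' : |n| = |n'|)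
    (h : root k ^ m * n = n') : m = 0 := by
  have habs := congrArg abs h
  rw [abs_mul, abs_of_pos (zpow_pos root_pos m), ← Int.cast_abs, ← Int.cast_abs, ← h'] at habs
  by_contra hm
  refine hm ((zpow_eq_one_iff_right₀ root_pos.le (root_ne_one hk)).1 ?_)
  exact mul_eq_right₀ (Int.cast_ne_zero.2 (abs_ne_zero.2 hn)) |>.1 habs

/-- The exponent sum of `x`. -/
def expX (k : ℕ) : BS k →* Multiplicative ℤ :=
  lift (.ofAdd 1) 1 (by group)

@[simp] theorem expX_x : expX k (x k) = .ofAdd 1 := lift_x ..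

@[simp] theorem expX_y : expX k (y k) = 1 := lift_y ..

end BS

/-! ### Chains of two Baumslag–Solitar type groups -/

namespace Chain

variable {k l : ℕ}

/-- The inclusions of the amalgamated infinite cyclic group into the two factors of `Chain`. -/
def base (k l : ℕ) : ∀ i : Bool, Multiplicative ℤ →* BS (bif i then l else k)
  | false => zpowersHom _ (BS.y k)
  | true => zpowersHom _ (BS.x l)

/-- The infinite cyclic subgroups of the two factors of `Chain` that generate its free core. -/
def ends (k l : ℕ) : ∀ i : Bool, Multiplicative ℤ →* BS (bif i then l else k)
  | false => zpowersHom _ (BS.x k)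
  | true => zpowersHom _ (BS.y l)

theorem base_injective (hk : k ≠ 0) (hl : l ≠ 0) (i : Bool) : Function.Injective (base k l i) := by
  rw [injective_iff_map_eq_one]
  cases i
  · exact fun n h => BS.y_zpow_eq_one hk h
  · exact fun n h => BS.x_zpow_eq_one hl h

theorem eq_one_of_ends_mem_range (hk : k ≠ 0) (hl : l ≠ 0) (i : Bool) (n : Multiplicative ℤ)
    (h : ends k l i n ∈ (base k l i).range) : n = 1 := by
  obtain ⟨m, hm⟩ := h
  cases i
  · exact (BS.eq_zero_of_x_zpow_eq_y_zpow hk hm.symm).1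
  · exact (BS.eq_zero_of_x_zpow_eq_y_zpow hl hm).2

end Chain

/-- The group `⟨x, t, y | x⁻ᵏ t xᵏ = t², t⁻ˡ y tˡ = y²⟩`, as the amalgam of `BS k` and `BS l` that
identifies the generator `y` of the former with the generator `x` of the latter. -/
abbrev Chain (k l : ℕ) : Type := PushoutI (Chain.base k l)

/-- The free group of rank two, as a free product of infinite cyclic groups. -/
abbrev Core : Type := CoprodI fun _ : Bool => Multiplicative ℤ

/-- The automorphism of `Core` that exchanges the two generators. -/
def Core.swap : Core →* Core :=
  CoprodI.lift fun i => CoprodI.of (M := fun _ : Bool => Multiplicative ℤ) (i := !i)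

theorem Core.swap_injective : Function.Injective Core.swap := by
  have : Core.swap.comp Core.swap = .id _ := by
    refine CoprodI.ext_hom _ _ fun i => ?_
    ext
    cases i <;> simp [Core.swap]
  exact Function.LeftInverse.injective fun x => DFunLike.congr_fun this x

namespace Chain

variable {k l : ℕ}

/-- The factor `⟨x, t⟩`. -/
def left (k l : ℕ) : BS k →* Chain k l := PushoutI.of (φ := base k l) false

/-- The factor `⟨t, y⟩`. -/
def right (k l : ℕ) : BS l →* Chain k l := PushoutI.of (φ := base k l) true

theorem left_injective (hk : k ≠ 0) (hl : l ≠ 0) : Function.Injective (left k l) :=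
  PushoutI.of_injective (base_injective hk hl) false

theorem right_injective (hk : k ≠ 0) (hl : l ≠ 0) : Function.Injective (right k l) :=
  PushoutI.of_injective (base_injective hk hl) true

theorem left_y : left k l (BS.y k) = right k l (BS.x l) := by
  have (i : Bool) := PushoutI.of_apply_eq_base (base k l) i (.ofAdd 1)
  simpa only [base, left, right, zpowersHom_apply, toAdd_ofAdd, zpow_one] using
    (this false).trans (this true).symm

theorem mem_zpowers_of_left_mem_right_range (hk : k ≠ 0) (hl : l ≠ 0) {g : BS k}
    (h : left k l g ∈ (right k l).range) : g ∈ Subgroup.zpowers (BS.y k) := by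
  have hφ := base_injective hk hl
  have : left k l g ∈ (PushoutI.base (base k l)).range :=
    (PushoutI.inf_of_range_eq_base_range hφ Bool.false_ne_true).le ⟨⟨g, rfl⟩, h⟩
  exact (of_mem_base_range_iff hφ (i := false)).1 this

theorem mem_zpowers_of_right_mem_left_range (hk : k ≠ 0) (hl : l ≠ 0) {g : BS l}
    (h : right k l g ∈ (left k l).range) : g ∈ Subgroup.zpowers (BS.x l) := by
  have hφ := base_injective hk hl
  have : right k l g ∈ (PushoutI.base (base k l)).range :=
    (PushoutI.inf_of_range_eq_base_range hφ Bool.false_ne_true).le ⟨h, ⟨g, rfl⟩⟩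
  exact (of_mem_base_range_iff hφ (i := true)).1 this

/-- The subgroup `⟨x, y⟩`. -/
def core (k l : ℕ) : Core →* Chain k l := coprodToPushout (base k l) (ends k l)

theorem core_injective (hk : k ≠ 0) (hl : l ≠ 0) : Function.Injective (core k l) :=
  coprodToPushout_injective (base_injective hk hl) (eq_one_of_ends_mem_range hk hl)

theorem core_of_false (n : Multiplicative ℤ) :
    core k l (CoprodI.of (i := false) n) = left k l (BS.x k ^ n.toAdd) := by
  rw [core, coprodToPushout, CoprodI.lift_of]
  rfl

theorem core_of_true (n : Multiplicative ℤ) :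
    core k l (CoprodI.of (i := true) n) = right k l (BS.y l ^ n.toAdd) := by
  rw [core, coprodToPushout, CoprodI.lift_of]
  rfl

theorem mem_zpowers_of_right_mem_core_range (hk : k ≠ 0) (hl : l ≠ 0) {g : BS l}
    (h : right k l g ∈ (core k l).range) : g ∈ Subgroup.zpowers (BS.y l) := by
  obtain ⟨x, hx⟩ := h
  have hmem : core k l x ∈ (right k l).range := ⟨g, hx.symm⟩
  obtain ⟨n, rfl⟩ := mem_range_of_coprodToPushout_mem (i := true) (base_injective hk hl)
    (eq_one_of_ends_mem_range hk hl) hmem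
  refine ⟨n.toAdd, right_injective hk hl ?_⟩
  exact (core_of_true n).symm.trans hx

/-- The retraction of the chain onto its left factor that sends `y` to `1`. -/
def killRight (k l : ℕ) : Chain k l →* BS k :=
  PushoutI.lift (fun | false => .id _ | true => BS.lift (BS.y k) 1 (by simp))
    (zpowersHom _ (BS.y k)) (by
      rintro (_ | _) <;> ext <;> simp [base])

@[simp] theorem killRight_left (g : BS k) : killRight k l (left k l g) = g := by
  rw [killRight, left, PushoutI.lift_of, MonoidHom.id_apply]

@[simp] theorem killRight_right_y : killRight k l (right k l (BS.y l)) = 1 := by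
  rw [killRight, right, PushoutI.lift_of]
  exact BS.lift_y ..

theorem killRight_mem_zpowers {g : Chain k l} (h : g ∈ (core k l).range) :
    killRight k l g ∈ Subgroup.zpowers (BS.x k) := by
  obtain ⟨g, rfl⟩ := h
  induction g using CoprodI.induction_on with
  | one => simp only [map_one, one_mem]
  | of i n => cases i <;> simp [core_of_false, core_of_true]
  | mul g h hg hh => simpa only [map_mul] using mul_mem hg hh

end Chain

/-! ### Embedding `Γ'` in an amalgam of chains -/

namespace Letter

/-- The letter acted on by conjugation with this letter, in the cyclic order `a, b, c, d`. -/
def next : Letter → Letter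
  | a => b
  | b => c
  | c => d
  | d => a

/-- The exponent `k` of the relation `ℓ⁻ᵏ ℓ' ℓᵏ = ℓ'²` between the letter `ℓ` and its successor
`ℓ'`. -/
def exponent : Letter → ℕ
  | a => 1
  | b => 2
  | c => 3
  | d => 4

theorem exponent_ne_zero (ℓ : Letter) : ℓ.exponent ≠ 0 := by cases ℓ <;> decide

theorem next_surjective : Function.Surjective next
  | a => ⟨d, rfl⟩
  | b => ⟨a, rfl⟩
  | c => ⟨b, rfl⟩
  | d => ⟨c, rfl⟩

end Letter

section Hom

variable {G : Type*} [Group G]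

/-- The homomorphism from `Γ'` given by four elements that satisfy the relations. -/
def homOfRel (f : Letter → G)
    (h : ∀ ℓ : Letter, (f ℓ ^ ℓ.exponent)⁻¹ * f ℓ.next * f ℓ ^ ℓ.exponent = f ℓ.next ^ 2) :
    Group' →* G :=
  PresentedGroup.toGroup (f := f) (by
    have ha := h .a
    have hb := h .b
    have hc := h .c
    have hd := h .d
    simp only [Letter.exponent, Letter.next, pow_one] at ha hb hc hd
    rintro r (rfl | rfl | rfl | rfl) <;>
      simp only [map_mul, map_inv, map_pow, FreeGroup.lift_apply_of, ha, hb, hc, hd,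
        mul_inv_cancel])

/-- The generators of `Γ'`. -/
def gen : Letter → Group' := PresentedGroup.of

@[simp] theorem homOfRel_gen (f : Letter → G)
    (h : ∀ ℓ : Letter, (f ℓ ^ ℓ.exponent)⁻¹ * f ℓ.next * f ℓ ^ ℓ.exponent = f ℓ.next ^ 2)
    (ℓ : Letter) : homOfRel f h (gen ℓ) = f ℓ :=
  PresentedGroup.toGroup.of _

theorem gen_rel (ℓ : Letter) :
    (gen ℓ ^ ℓ.exponent)⁻¹ * gen ℓ.next * gen ℓ ^ ℓ.exponent = gen ℓ.next ^ 2 :=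
  PresentedGroup.mk_eq_mk_of_mul_inv_mem (by
    cases ℓ <;> simp [relators, Letter.exponent, Letter.next])

end Hom

/-- The homomorphism of the group with the single relation between `ℓ` and its successor into
`Γ'`. -/
def ofBS (ℓ : Letter) : BS ℓ.exponent →* Group' := BS.lift (gen ℓ) (gen ℓ.next) (gen_rel ℓ)

@[simp] theorem ofBS_x (ℓ : Letter) : ofBS ℓ (BS.x _) = gen ℓ := BS.lift_x ..

@[simp] theorem ofBS_y (ℓ : Letter) : ofBS ℓ (BS.y _) = gen ℓ.next := BS.lift_y ..

namespace Tower

/-- The inclusions of the free group `⟨a, c⟩` into the two factors of `Tower`. -/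
def base : ∀ i : Bool, Core →* Chain (bif i then 3 else 1) (bif i then 4 else 2)
  | false => Chain.core 1 2
  | true => (Chain.core 3 4).comp Core.swap

theorem base_injective : ∀ i, Function.Injective (base i)
  | false => Chain.core_injective one_ne_zero two_ne_zero
  | true => (Chain.core_injective three_ne_zero four_ne_zero).comp Core.swap_injective

end Tower

/-- The amalgam of the chains `⟨a, b, c⟩` and `⟨c, d, a⟩` over the free group `⟨a, c⟩`. -/
abbrev Tower : Type := PushoutI Tower.base

namespace Tower

/-- The factor `⟨a, b, c⟩`. -/
def abc : Chain 1 2 →* Tower := PushoutI.of (φ := base) false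

/-- The factor `⟨c, d, a⟩`. -/
def cda : Chain 3 4 →* Tower := PushoutI.of (φ := base) true

theorem abc_injective : Function.Injective abc := PushoutI.of_injective base_injective false

theorem cda_injective : Function.Injective cda := PushoutI.of_injective base_injective true

theorem abc_core (g : Core) : abc (Chain.core 1 2 g) = cda (Chain.core 3 4 (Core.swap g)) :=
  (PushoutI.of_apply_eq_base base false g).trans (PushoutI.of_apply_eq_base base true g).symm

theorem abc_left_x : abc (Chain.left 1 2 (BS.x 1)) = cda (Chain.right 3 4 (BS.y 4)) := by
  simpa [Chain.core_of_false, Chain.core_of_true, Core.swap] using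
    abc_core (CoprodI.of (i := false) (.ofAdd 1))

theorem abc_right_y : abc (Chain.right 1 2 (BS.y 2)) = cda (Chain.left 3 4 (BS.x 3)) := by
  simpa [Chain.core_of_false, Chain.core_of_true, Core.swap] using
    abc_core (CoprodI.of (i := true) (.ofAdd 1))

theorem mem_core_range_of_cda_mem {g : Chain 3 4} (h : cda g ∈ abc.range) :
    g ∈ (Chain.core 3 4).range := by
  have : cda g ∈ (PushoutI.base base).range :=
    (PushoutI.inf_of_range_eq_base_range base_injective Bool.false_ne_true).le ⟨h, ⟨g, rfl⟩⟩
  obtain ⟨x, hx⟩ := (of_mem_base_range_iff base_injective (i := true)).1 this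
  exact ⟨Core.swap x, hx⟩

theorem mem_core_range_of_abc_mem {g : Chain 1 2} (h : abc g ∈ cda.range) :
    g ∈ (Chain.core 1 2).range := by
  have : abc g ∈ (PushoutI.base base).range :=
    (PushoutI.inf_of_range_eq_base_range base_injective Bool.false_ne_true).le ⟨⟨g, rfl⟩, h⟩
  exact (of_mem_base_range_iff base_injective (i := false)).1 this

/-- The images of the generators of `Γ'`. -/
def gen : Letter → Tower
  | .a => abc (Chain.left 1 2 (BS.x 1))
  | .b => abc (Chain.left 1 2 (BS.y 1))
  | .c => cda (Chain.left 3 4 (BS.x 3))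
  | .d => cda (Chain.left 3 4 (BS.y 3))

/-- The two-generator subgroups of the factors. -/
def ofBS : ∀ ℓ : Letter, BS ℓ.exponent →* Tower
  | .a => abc.comp (Chain.left 1 2)
  | .b => abc.comp (Chain.right 1 2)
  | .c => cda.comp (Chain.left 3 4)
  | .d => cda.comp (Chain.right 3 4)

theorem ofBS_injective : ∀ ℓ, Function.Injective (ofBS ℓ)
  | .a => abc_injective.comp (Chain.left_injective one_ne_zero two_ne_zero)
  | .b => abc_injective.comp (Chain.right_injective one_ne_zero two_ne_zero)
  | .c => cda_injective.comp (Chain.left_injective three_ne_zero four_ne_zero)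
  | .d => cda_injective.comp (Chain.right_injective three_ne_zero four_ne_zero)

theorem ofBS_b_mem_range_a_iff {g : BS Letter.b.exponent} :
    ofBS .b g ∈ (ofBS .a).range ↔ Chain.right 1 2 g ∈ (Chain.left 1 2).range :=
  ⟨fun ⟨x, hx⟩ => ⟨x, abc_injective hx⟩, fun ⟨x, hx⟩ => ⟨x, congrArg abc hx⟩⟩

theorem ofBS_a_mem_range_b_iff {g : BS Letter.a.exponent} :
    ofBS .a g ∈ (ofBS .b).range ↔ Chain.left 1 2 g ∈ (Chain.right 1 2).range :=
  ⟨fun ⟨x, hx⟩ => ⟨x, abc_injective hx⟩, fun ⟨x, hx⟩ => ⟨x, congrArg abc hx⟩⟩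

theorem ofBS_x (ℓ : Letter) : ofBS ℓ (BS.x _) = gen ℓ := by
  cases ℓ
  · rfl
  · exact congrArg abc Chain.left_y.symm
  · rfl
  · exact congrArg cda Chain.left_y.symm

theorem ofBS_y (ℓ : Letter) : ofBS ℓ (BS.y _) = gen ℓ.next := by
  cases ℓ
  · rfl
  · exact abc_right_y
  · rfl
  · exact abc_left_x.symm

end Tower

/-- The homomorphism from `Γ'` to the amalgam that sends generators to generators. -/
def toTower : Group' →* Tower :=
  homOfRel Tower.gen fun ℓ => by
    rw [← Tower.ofBS_x, ← Tower.ofBS_y]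
    simp only [← map_pow, ← map_inv, ← map_mul, BS.rel]

theorem toTower_gen (ℓ : Letter) : toTower (gen ℓ) = Tower.gen ℓ := homOfRel_gen ..

theorem toTower_ofBS (ℓ : Letter) (g : BS ℓ.exponent) : toTower (ofBS ℓ g) = Tower.ofBS ℓ g := by
  have hx : toTower (ofBS ℓ (BS.x _)) = Tower.ofBS ℓ (BS.x _) := by
    rw [ofBS_x, toTower_gen, Tower.ofBS_x]
  have hy : toTower (ofBS ℓ (BS.y _)) = Tower.ofBS ℓ (BS.y _) := by
    rw [ofBS_y, toTower_gen, Tower.ofBS_y]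
  exact DFunLike.congr_fun (BS.hom_ext (G := Tower) (f := toTower.comp (ofBS ℓ)) hx hy) g

theorem ofBS_injective (ℓ : Letter) : Function.Injective (ofBS ℓ) := fun g h hgh =>
  Tower.ofBS_injective ℓ (by rw [← toTower_ofBS, ← toTower_ofBS, hgh])

section Subgroups

/-- The preimage in `Γ'` of the factor `⟨a, b, c⟩` of `Tower`. -/
def subgroupABC : Subgroup Group' := Tower.abc.range.comap (N := Tower) toTower

/-- The preimage in `Γ'` of the factor `⟨c, d, a⟩` of `Tower`. -/
def subgroupCDA : Subgroup Group' := Tower.cda.range.comap (N := Tower) toTower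

/-- The preimage in `Γ'` of the subgroup `⟨a, b⟩` of `Tower`. -/
def subgroupAB : Subgroup Group' := (Tower.ofBS .a).range.comap (N := Tower) toTower

/-- The preimage in `Γ'` of the subgroup `⟨b, c⟩` of `Tower`. -/
def subgroupBC : Subgroup Group' := (Tower.ofBS .b).range.comap (N := Tower) toTower

theorem gen_mem_subgroupAB {ℓ : Letter} (h : ℓ = .a ∨ ℓ = .b) : gen ℓ ∈ subgroupAB := by
  rcases h with rfl | rfl
  · exact ⟨BS.x 1, (toTower_gen .a).symm⟩
  · exact ⟨BS.y 1, (toTower_gen .b).symm⟩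

theorem gen_mem_subgroupBC {ℓ : Letter} (h : ℓ = .b ∨ ℓ = .c) : gen ℓ ∈ subgroupBC := by
  rcases h with rfl | rfl
  · exact ⟨BS.x 2, (Tower.ofBS_x .b).trans (toTower_gen .b).symm⟩
  · exact ⟨BS.y 2, (Tower.ofBS_y .b).trans (toTower_gen .c).symm⟩

theorem subgroupAB_le_subgroupABC : subgroupAB ≤ subgroupABC := fun _ ⟨_, h⟩ => ⟨_, h⟩

theorem subgroupBC_le_subgroupABC : subgroupBC ≤ subgroupABC := fun _ ⟨_, h⟩ => ⟨_, h⟩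

theorem gen_mem_subgroupABC {ℓ : Letter} (h : ℓ ≠ .d) : gen ℓ ∈ subgroupABC := by
  cases ℓ
  · exact subgroupAB_le_subgroupABC (gen_mem_subgroupAB (.inl rfl))
  · exact subgroupAB_le_subgroupABC (gen_mem_subgroupAB (.inr rfl))
  · exact subgroupBC_le_subgroupABC (gen_mem_subgroupBC (.inr rfl))
  · exact absurd rfl h

theorem gen_mem_subgroupCDA {ℓ : Letter} (h : ℓ ≠ .b) : gen ℓ ∈ subgroupCDA := by
  cases ℓ
  · exact ⟨_, (Tower.ofBS_y .d).trans (toTower_gen .a).symm⟩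
  · exact absurd rfl h
  · exact ⟨_, (toTower_gen .c).symm⟩
  · exact ⟨_, (toTower_gen .d).symm⟩

theorem mul_mul_notMem_subgroupABC {p q r : Group'} (hp : p ∈ subgroupCDA)
    (hp' : p ∉ subgroupABC) (hq : q ∈ subgroupABC) (hq' : q ∉ subgroupCDA) (hr : r ∈ subgroupCDA)
    (hr' : r ∉ subgroupABC) : p * q * r ∉ subgroupABC := by
  have := mul_mul_notMem_of_range Tower.base_injective Bool.false_ne_true hp hp' hq hq' hr hr'
  rw [← map_mul, ← map_mul] at this
  exact this

theorem mul_mul_notMem_subgroupAB {p q r : Group'} (hp : p ∈ subgroupBC)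
    (hp' : p ∉ subgroupAB) (hq : q ∈ subgroupAB) (hq' : q ∉ subgroupBC) (hr : r ∈ subgroupBC)
    (hr' : r ∉ subgroupAB) : p * q * r ∉ subgroupAB := by
  obtain ⟨p₀, hp₀⟩ := hp
  obtain ⟨q₀, hq₀⟩ := hq
  obtain ⟨r₀, hr₀⟩ := hr
  rw [subgroupAB, Subgroup.mem_comap, ← hp₀, Tower.ofBS_b_mem_range_a_iff] at hp'
  rw [subgroupBC, Subgroup.mem_comap, ← hq₀, Tower.ofBS_a_mem_range_b_iff] at hq'
  rw [subgroupAB, Subgroup.mem_comap, ← hr₀, Tower.ofBS_b_mem_range_a_iff] at hr'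
  have := mul_mul_notMem_of_range (Chain.base_injective one_ne_zero two_ne_zero)
    Bool.false_ne_true ⟨p₀, rfl⟩ hp' ⟨q₀, rfl⟩ hq' ⟨r₀, rfl⟩ hr'
  rintro ⟨g, hg⟩
  rw [map_mul, map_mul, ← hp₀, ← hq₀, ← hr₀] at hg
  refine this ⟨g, Tower.abc_injective (hg.trans ?_)⟩
  rw [map_mul, map_mul]
  rfl

theorem mem_zpowers_of_ofBS_d_mem {g : BS Letter.d.exponent} (h : ofBS .d g ∈ subgroupABC) :
    g ∈ Subgroup.zpowers (BS.y _) := by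
  rw [subgroupABC, Subgroup.mem_comap, toTower_ofBS] at h
  exact Chain.mem_zpowers_of_right_mem_core_range three_ne_zero four_ne_zero
    (Tower.mem_core_range_of_cda_mem h)

theorem mem_zpowers_of_ofBS_b_mem_CDA {g : BS Letter.b.exponent} (h : ofBS .b g ∈ subgroupCDA) :
    g ∈ Subgroup.zpowers (BS.y _) := by
  rw [subgroupCDA, Subgroup.mem_comap, toTower_ofBS] at h
  exact Chain.mem_zpowers_of_right_mem_core_range one_ne_zero two_ne_zero
    (Tower.mem_core_range_of_abc_mem h)

theorem mem_zpowers_of_ofBS_b_mem_AB {g : BS Letter.b.exponent} (h : ofBS .b g ∈ subgroupAB) :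
    g ∈ Subgroup.zpowers (BS.x _) := by
  rw [subgroupAB, Subgroup.mem_comap, toTower_ofBS, Tower.ofBS_b_mem_range_a_iff] at h
  exact Chain.mem_zpowers_of_right_mem_left_range one_ne_zero two_ne_zero h

theorem mem_zpowers_of_ofBS_a_mem_BC {g : BS Letter.a.exponent} (h : ofBS .a g ∈ subgroupBC) :
    g ∈ Subgroup.zpowers (BS.y _) := by
  rw [subgroupBC, Subgroup.mem_comap, toTower_ofBS, Tower.ofBS_a_mem_range_b_iff] at h
  exact Chain.mem_zpowers_of_left_mem_right_range one_ne_zero two_ne_zero h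

theorem eq_zero_of_gen_d_zpow_mem {n : ℤ} (h : gen .d ^ n ∈ subgroupABC) : n = 0 := by
  rw [← ofBS_x, ← map_zpow] at h
  obtain ⟨m, hm⟩ := mem_zpowers_of_ofBS_d_mem h
  exact (BS.eq_zero_of_x_zpow_eq_y_zpow four_ne_zero hm.symm).1

theorem eq_zero_of_gen_b_zpow_mem {n : ℤ} (h : gen .b ^ n ∈ subgroupCDA) : n = 0 := by
  rw [← ofBS_x, ← map_zpow] at h
  obtain ⟨m, hm⟩ := mem_zpowers_of_ofBS_b_mem_CDA h
  exact (BS.eq_zero_of_x_zpow_eq_y_zpow two_ne_zero hm.symm).1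

theorem eq_zero_of_gen_c_zpow_mem {n : ℤ} (h : gen .c ^ n ∈ subgroupAB) : n = 0 := by
  obtain ⟨m, hm⟩ := mem_zpowers_of_ofBS_b_mem_AB (g := BS.y _ ^ n)
    (by simpa [Letter.next] using h)
  exact (BS.eq_zero_of_x_zpow_eq_y_zpow two_ne_zero hm).2

theorem eq_zero_of_gen_a_zpow_mem {n : ℤ} (h : gen .a ^ n ∈ subgroupBC) : n = 0 := by
  rw [← ofBS_x, ← map_zpow] at h
  obtain ⟨m, hm⟩ := mem_zpowers_of_ofBS_a_mem_BC h
  exact (BS.eq_zero_of_x_zpow_eq_y_zpow one_ne_zero hm.symm).1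

theorem four_dvd_of_gen_d_zpow_mul_mem {n i n' : ℤ} (hi : i ≠ 0)
    (h : gen .d ^ n * gen .a ^ i * gen .d ^ n' ∈ subgroupABC) : 4 ∣ n := by
  obtain ⟨m, hm⟩ := mem_zpowers_of_ofBS_d_mem (g := BS.x _ ^ n * BS.y _ ^ i * BS.x _ ^ n')
    (by simpa [Letter.next] using h)
  exact BS.dvd_of_root_zpow_mul_eq four_ne_zero hi
    (BS.root_zpow_mul_eq_of_conj four_ne_zero hm.symm)

theorem add_root_zpow_mul_eq_zero_of_gen_c_mem {n m n' : ℤ}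
    (h : gen .c ^ n * gen .b ^ m * gen .c ^ n' ∈ subgroupAB) : n + BS.root 2 ^ m * n' = 0 := by
  obtain ⟨i, hi⟩ := mem_zpowers_of_ofBS_b_mem_AB (g := BS.y _ ^ n * BS.x _ ^ m * BS.y _ ^ n')
    (by simpa [Letter.next] using h)
  exact BS.add_root_zpow_mul_eq_zero two_ne_zero hi.symm

theorem add_root_zpow_mul_eq_zero_of_gen_d_mem {n i m j n' : ℤ}
    (h : gen .d ^ n * (gen .a ^ i * gen .c ^ m * gen .a ^ j) * gen .d ^ n' ∈ subgroupABC) :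
    n + BS.root 3 ^ m * n' = 0 := by
  let c : Chain 3 4 := Chain.left 3 4 (BS.x 3)
  let d : Chain 3 4 := Chain.left 3 4 (BS.y 3)
  let a : Chain 3 4 := Chain.right 3 4 (BS.y 4)
  have ha : toTower (gen .a) = Tower.cda a := (toTower_gen .a).trans Tower.abc_left_x
  have hc : toTower (gen .c) = Tower.cda c := toTower_gen .c
  have hd : toTower (gen .d) = Tower.cda d := toTower_gen .d
  rw [subgroupABC, Subgroup.mem_comap] at h
  simp only [map_mul, map_zpow, ha, hc, hd] at h
  simp only [← map_mul, ← map_zpow] at h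
  obtain ⟨k, hk⟩ := Chain.killRight_mem_zpowers (Tower.mem_core_range_of_cda_mem h)
  simp only [map_mul, map_zpow, a, c, d, Chain.killRight_left, Chain.killRight_right_y, one_zpow,
    one_mul, mul_one] at hk
  exact BS.add_root_zpow_mul_eq_zero three_ne_zero hk.symm

end Subgroups

/-! ### Short reduced words -/

/-- The exponent of a signed letter. -/
def sign (e : Bool) : ℤ := cond e 1 (-1)

theorem abs_sign (e : Bool) : |sign e| = 1 := by cases e <;> rfl

theorem sign_ne_zero (e : Bool) : sign e ≠ 0 := by cases e <;> decide

theorem sign_not (e : Bool) : sign (!e) = -sign e := by cases e <;> rfl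

/-- The element of `Γ'` represented by a word in the letters and their inverses. -/
def word (L : List (Letter × Bool)) : Group' := (L.map fun s => gen s.1 ^ sign s.2).prod

@[simp] theorem word_nil : word [] = 1 := rfl

@[simp] theorem word_cons (s : Letter × Bool) (L : List (Letter × Bool)) :
    word (s :: L) = gen s.1 ^ sign s.2 * word L := List.prod_cons

@[simp] theorem word_append (L M : List (Letter × Bool)) : word (L ++ M) = word L * word M := by
  simp [word]

@[simp] theorem word_replicate (n : ℕ) (s : Letter × Bool) :
    word (List.replicate n s) = gen s.1 ^ (sign s.2 * n) := by
  simp [word, zpow_mul]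

theorem word_mem {K : Subgroup Group'} {L : List (Letter × Bool)} (h : ∀ s ∈ L, gen s.1 ∈ K) :
    word L ∈ K :=
  list_prod_mem fun _ hg => by
    obtain ⟨s, hs, rfl⟩ := List.mem_map.1 hg
    exact zpow_mem (h s hs) _

section Reduced

variable {α : Type*} {L : List (α × Bool)}

theorem exists_replicate_append {s : α × Bool} (h : IsReduced (s :: L)) :
    ∃ n r, L = List.replicate n s ++ r ∧ ∀ t ∈ r.head?, t.1 ≠ s.1 := by
  induction L with
  | nil => exact ⟨0, [], rfl, by simp⟩
  | cons t L ih =>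
    rw [FreeGroup.isReduced_cons_cons] at h
    by_cases hts : t.1 = s.1
    · obtain rfl : s = t := Prod.ext hts.symm (h.1 hts.symm)
      obtain ⟨n, r, rfl, hr⟩ := ih h.2
      exact ⟨n + 1, r, rfl, hr⟩
    · exact ⟨0, t :: L, rfl, by simpa using hts⟩

theorem exists_append_replicate_append {ℓ : α} (hL : IsReduced L) (h : ∃ s ∈ L, s.1 = ℓ) :
    ∃ p n e r, L = p ++ (List.replicate (n + 1) (ℓ, e) ++ r) ∧ (∀ s ∈ p, s.1 ≠ ℓ) ∧
      ∀ t ∈ r.head?, t.1 ≠ ℓ := by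
  induction L with
  | nil => simp at h
  | cons s L ih =>
    by_cases hs : s.1 = ℓ
    · obtain ⟨n, r, rfl, hr⟩ := exists_replicate_append hL
      subst hs
      exact ⟨[], n, s.2, r, rfl, by simp, hr⟩
    · obtain ⟨p, n, e, r, rfl, hp, hr⟩ := ih (hL.infix (List.suffix_cons s L).isInfix)
        (by simpa [hs] using h)
      exact ⟨s :: p, n, e, r, rfl, by simpa [hs] using hp, hr⟩

theorem eq_replicate_of_forall_fst_eq {ℓ : α} (hL : IsReduced L) (h : ∀ s ∈ L, s.1 = ℓ) :
    ∃ e, L = List.replicate L.length (ℓ, e) := by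
  cases L with
  | nil => exact ⟨true, rfl⟩
  | cons s L =>
    obtain ⟨n, r, rfl, hr⟩ := exists_replicate_append hL
    obtain rfl := h s (by simp)
    cases r with
    | nil => exact ⟨s.2, by simp [List.replicate_succ]⟩
    | cons t r => exact absurd (h t (by simp)) (hr t rfl)

end Reduced

theorem word_notMem {K : Subgroup Group'} {ℓ : Letter} {L : List (Letter × Bool)}
    (hL : IsReduced L) (hlen : L.length ≤ 4)
    (hℓ : ∃ s ∈ L, s.1 = ℓ) (hK : ∀ s ∈ L, s.1 ≠ ℓ → gen s.1 ∈ K)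
    (h_pow : ∀ n : ℤ, gen ℓ ^ n ∈ K → n = 0)
    (h_conj : ∀ (n n' : ℤ) (u : List (Letter × Bool)), n ≠ 0 → n' ≠ 0 → u ≠ [] → IsReduced u →
      (∀ s ∈ u, s ∈ L ∧ s.1 ≠ ℓ) → n.natAbs + u.length + n'.natAbs ≤ L.length →
      gen ℓ ^ n * word u * gen ℓ ^ n' ∉ K) :
    word L ∉ K := by
  obtain ⟨p, n, e, r, rfl, hp, hr⟩ := exists_append_replicate_append hL hℓ
  have hpK : word p ∈ K := word_mem fun s hs => hK s (by simp [hs]) (hp s hs)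
  rw [word_append, K.mul_mem_cancel_left hpK, word_append, word_replicate]
  by_cases hrℓ : ∃ s ∈ r, s.1 = ℓ
  · obtain ⟨p', n', e', r', rfl, hp', hr'⟩ := exists_append_replicate_append
      (hL.infix ⟨p ++ List.replicate (n + 1) (ℓ, e), [], by simp⟩) hrℓ
    have hne : p' ≠ [] := by
      rintro rfl
      exact hr (ℓ, e') (by simp [List.replicate_succ]) rfl
    have hpos := List.length_pos_iff.2 hne
    simp only [List.length_append, List.length_replicate] at hlen
    have hr'ℓ : ∀ s ∈ r', s.1 ≠ ℓ := by
      cases r' with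
      | nil => simp
      | cons t r' =>
        have : r' = [] := List.length_eq_zero_iff.1 (by simp only [List.length_cons] at hlen; omega)
        simpa [this] using hr'
    have hr'K : word r' ∈ K := word_mem fun s hs => hK s (by simp [hs]) (hr'ℓ s hs)
    rw [word_append, word_append, word_replicate, ← mul_assoc, ← mul_assoc,
      K.mul_mem_cancel_right hr'K]
    refine h_conj _ _ _ (mul_ne_zero (sign_ne_zero e) (by omega))
      (mul_ne_zero (sign_ne_zero e') (by omega)) hne
      (hL.infix ⟨p ++ List.replicate (n + 1) (ℓ, e), List.replicate (n' + 1) (ℓ, e') ++ r',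
        by simp⟩) (fun s hs => ⟨by simp [hs], hp' s hs⟩) ?_
    cases e <;> cases e' <;> simp [sign] <;> omega
  · push Not at hrℓ
    rw [K.mul_mem_cancel_right (word_mem fun s hs => hK s (by simp [hs]) (hrℓ s hs))]
    exact fun h => mul_ne_zero (sign_ne_zero e) (by omega) (h_pow _ h)

section Membership

variable {L : List (Letter × Bool)}

theorem word_notMem_subgroupCDA (hL : IsReduced L) (hlen : L.length ≤ 2)
    (hb : ∃ s ∈ L, s.1 = .b) : word L ∉ subgroupCDA :=
  word_notMem hL (by omega) hb (fun _ _ => gen_mem_subgroupCDA) (fun _ => eq_zero_of_gen_b_zpow_mem)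
    fun n n' u hn hn' hu _ _ hle => by
      have := List.length_pos_iff.2 hu
      omega

theorem word_notMem_subgroupBC (hL : IsReduced L) (hlen : L.length ≤ 2)
    (hd : ∀ s ∈ L, s.1 ≠ .d) (ha : ∃ s ∈ L, s.1 = .a) : word L ∉ subgroupBC :=
  word_notMem hL (by omega) ha
    (fun s hs hsa => gen_mem_subgroupBC (by have := hd s hs; cases h : s.1 <;> simp_all))
    (fun _ => eq_zero_of_gen_a_zpow_mem) fun n n' u hn hn' hu _ _ hle => by
      have := List.length_pos_iff.2 hu
      omega

theorem exists_word_eq_a_c_a (hL : IsReduced L) (hne : L ≠ []) (hlen : L.length ≤ 2)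
    (hac : ∀ s ∈ L, s.1 = .a ∨ s.1 = .c) :
    ∃ i m j : ℤ, word L = gen .a ^ i * gen .c ^ m * gen .a ^ j ∧ |m| ≤ 2 ∧
      (m = 0 → i ≠ 0 ∧ j = 0) := by
  match L, hne, hlen with
  | [(ℓ, e)], _, _ =>
    obtain rfl | rfl : ℓ = .a ∨ ℓ = .c := by simpa using hac
    · exact ⟨sign e, 0, 0, by simp, by simp, by simp [sign_ne_zero]⟩
    · exact ⟨0, sign e, 0, by simp, by simp [abs_sign], by simp [sign_ne_zero]⟩
  | [(ℓ, e), (ℓ', f)], _, _ =>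
    simp only [FreeGroup.isReduced_cons_cons, IsReduced.singleton, and_true] at hL
    obtain ⟨rfl | rfl, rfl | rfl⟩ : (ℓ = .a ∨ ℓ = .c) ∧ (ℓ' = .a ∨ ℓ' = .c) := by simpa using hac
    · obtain rfl := hL rfl
      exact ⟨sign e + sign e, 0, 0, by simp [zpow_add], by simp,
        fun _ => ⟨by cases e <;> decide, rfl⟩⟩
    · exact ⟨sign e, sign f, 0, by simp, by simp [abs_sign], by simp [sign_ne_zero]⟩
    · exact ⟨0, sign e, sign f, by simp, by simp [abs_sign], by simp [sign_ne_zero]⟩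
    · obtain rfl := hL rfl
      exact ⟨0, sign e + sign e, 0, by simp [zpow_add], by cases e <;> decide,
        by cases e <;> simp [sign]⟩

theorem word_notMem_subgroupABC (hL : IsReduced L) (hlen : L.length ≤ 4)
    (hd : ∃ s ∈ L, s.1 = .d) : word L ∉ subgroupABC := by
  refine word_notMem hL hlen hd (fun _ _ => gen_mem_subgroupABC)
    (fun _ => eq_zero_of_gen_d_zpow_mem) fun n n' u hn hn' hu hru huL hle => ?_
  by_cases hb : ∃ s ∈ u, s.1 = .b
  · exact mul_mul_notMem_subgroupABC (zpow_mem (gen_mem_subgroupCDA (by simp)) _)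
      (fun h => hn (eq_zero_of_gen_d_zpow_mem h))
      (word_mem fun s hs => gen_mem_subgroupABC (huL s hs).2)
      (word_notMem_subgroupCDA hru (by omega) hb) (zpow_mem (gen_mem_subgroupCDA (by simp)) _)
      (fun h => hn' (eq_zero_of_gen_d_zpow_mem h))
  · push Not at hb
    obtain ⟨i, m, j, hword, hm, hm0⟩ := exists_word_eq_a_c_a hru hu (by omega) fun s hs => by
      have := (huL s hs).2
      have := hb s hs
      cases h : s.1 <;> simp_all
    rw [hword]
    intro h
    by_cases hmz : m = 0
    · obtain ⟨hi, rfl⟩ := hm0 hmz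
      subst hmz
      have := four_dvd_of_gen_d_zpow_mul_mem hi (by simpa using h)
      have := List.length_pos_iff.2 hu
      omega
    · have h0 := add_root_zpow_mul_eq_zero_of_gen_d_mem h
      have : (3 : ℤ) ∣ m := BS.dvd_of_root_zpow_mul_eq (n := n') (n' := -n) three_ne_zero hn'
        (by push_cast; linarith)
      rw [abs_le] at hm
      omega

theorem word_notMem_subgroupAB (hL : IsReduced L) (hlen : L.length ≤ 4) (hd : ∀ s ∈ L, s.1 ≠ .d)
    (hc : ∃ s ∈ L, s.1 = .c) : word L ∉ subgroupAB := by
  have mem_AB (s) (hs : s ∈ L) (hsc : s.1 ≠ .c) : s.1 = .a ∨ s.1 = .b := by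
    have := hd s hs
    cases h : s.1 <;> simp_all
  refine word_notMem hL hlen hc (fun s hs hsc => gen_mem_subgroupAB (mem_AB s hs hsc))
    (fun _ => eq_zero_of_gen_c_zpow_mem) fun n n' u hn hn' hu hru huL hle => ?_
  have hpos := List.length_pos_iff.2 hu
  by_cases ha : ∃ s ∈ u, s.1 = .a
  · exact mul_mul_notMem_subgroupAB (zpow_mem (gen_mem_subgroupBC (.inr rfl)) _)
      (fun h => hn (eq_zero_of_gen_c_zpow_mem h))
      (word_mem fun s hs => gen_mem_subgroupAB (mem_AB s (huL s hs).1 (huL s hs).2))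
      (word_notMem_subgroupBC hru (by omega) (fun s hs => hd s (huL s hs).1) ha)
      (zpow_mem (gen_mem_subgroupBC (.inr rfl)) _)
      (fun h => hn' (eq_zero_of_gen_c_zpow_mem h))
  · push Not at ha
    obtain ⟨e, hu_eq⟩ := eq_replicate_of_forall_fst_eq hru fun s hs =>
      (mem_AB s (huL s hs).1 (huL s hs).2).resolve_left (ha s hs)
    rw [hu_eq, word_replicate]
    intro h
    have h0 := add_root_zpow_mul_eq_zero_of_gen_c_mem h
    have root_mul_eq : BS.root 2 ^ (sign e * u.length) * (n' : ℤ) = (-n : ℤ) := by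
      push_cast
      linarith
    have two_dvd : (2 : ℤ) ∣ sign e * u.length :=
      BS.dvd_of_root_zpow_mul_eq two_ne_zero hn' root_mul_eq
    have hlen2 : u.length = 2 := by
      cases e <;> simp only [sign, cond_true, cond_false] at two_dvd <;> omega
    refine mul_ne_zero (sign_ne_zero e) (Nat.cast_ne_zero.2 hpos.ne')
      (BS.eq_zero_of_root_zpow_mul_eq two_ne_zero hn' ?_ root_mul_eq)
    rw [abs_neg, Int.abs_eq_natAbs, Int.abs_eq_natAbs]
    omega

theorem word_ne_one (hL : IsReduced L) (hne : L ≠ []) (hlen : L.length ≤ 2) : word L ≠ 1 := by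
  intro h
  have hd : ∀ s ∈ L, s.1 ≠ .d := fun s hs hsd =>
    word_notMem_subgroupABC hL (by omega) ⟨s, hs, hsd⟩ (h ▸ one_mem _)
  have hc : ∀ s ∈ L, s.1 ≠ .c := fun s hs hsc =>
    word_notMem_subgroupAB hL (by omega) hd ⟨s, hs, hsc⟩ (h ▸ one_mem _)
  have ha : ∀ s ∈ L, s.1 ≠ .a := fun s hs hsa =>
    word_notMem_subgroupBC hL hlen hd ⟨s, hs, hsa⟩ (h ▸ one_mem _)
  obtain ⟨s, hs⟩ := List.exists_mem_of_ne_nil L hne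
  refine word_notMem_subgroupCDA hL hlen ⟨s, hs, ?_⟩ (h ▸ one_mem _)
  have := hd s hs
  have := hc s hs
  have := ha s hs
  cases h : s.1 <;> simp_all

end Membership

/-! ### Relations of length five and seven -/

theorem gen_zpow_eq_one {ℓ : Letter} {n : ℤ} (h : gen ℓ ^ n = 1) : n = 0 :=
  BS.x_zpow_eq_one ℓ.exponent_ne_zero (ofBS_injective ℓ (by simpa using h))

/-- A closed walk of length five without backtracking in the Cayley graph, given by its edge
labels. -/
structure IsPentagon (s t u v w : Letter × Bool) : Prop where
  reduced : IsReduced [s, t, u, v, w, s]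
  word_eq_one : word [s, t, u, v, w] = 1

section Pentagon

variable {s t u v w : Letter × Bool}

namespace IsPentagon

theorem rotate (h : IsPentagon s t u v w) : IsPentagon t u v w s where
  reduced := by
    have := h.reduced
    simp only [FreeGroup.isReduced_cons_cons, IsReduced.singleton] at this ⊢
    tauto
  word_eq_one := by
    have := h.word_eq_one
    simp only [word_cons, word_nil, mul_one] at this ⊢
    rw [mul_eq_one_iff_inv_eq, eq_comm] at this
    simp only [← mul_assoc] at this ⊢
    rw [this, inv_mul_cancel]

theorem word_tail_mem (h : IsPentagon s t u v w) {K : Subgroup Group'} (hs : gen s.1 ∈ K) :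
    word [t, u, v, w] ∈ K :=
  (K.mul_mem_cancel_left (zpow_mem hs (sign s.2))).1 (by
    rw [← word_cons, h.word_eq_one]
    exact one_mem K)

theorem reduced_tail (h : IsPentagon s t u v w) : IsReduced [t, u, v, w] :=
  h.reduced.infix ⟨[s], [s], rfl⟩

theorem not_forall_fst_eq (h : IsPentagon s t u v w) {ℓ : Letter} :
    ¬ ∀ x ∈ [s, t, u, v, w], x.1 = ℓ := fun hℓ => by
  obtain ⟨e, he⟩ := eq_replicate_of_forall_fst_eq
    (h.reduced.infix (L₁ := [s, t, u, v, w]) ⟨[], [s], rfl⟩) hℓ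
  have hword := h.word_eq_one
  rw [he, word_replicate] at hword
  exact mul_ne_zero (sign_ne_zero e) (by simp) (gen_zpow_eq_one hword)

theorem fst_ne_of_forall_tail {ℓ : Letter}
    (hℓ : ∀ {s t u v w}, IsPentagon s t u v w → s.1 ≠ ℓ → ∀ x ∈ [t, u, v, w], x.1 ≠ ℓ)
    (h : IsPentagon s t u v w) : s.1 ≠ ℓ := by
  intro hs
  have ht : t.1 = ℓ := by_contra fun ht => hℓ h.rotate ht s (by simp) hs
  have hu : u.1 = ℓ := by_contra fun hu => hℓ h.rotate.rotate hu s (by simp) hs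
  have hv : v.1 = ℓ := by_contra fun hv => hℓ h.rotate.rotate.rotate hv s (by simp) hs
  have hw : w.1 = ℓ := by_contra fun hw => hℓ h.rotate.rotate.rotate.rotate hw s (by simp) hs
  exact h.not_forall_fst_eq (ℓ := ℓ) (by simp [*])

theorem fst_ne_d (h : IsPentagon s t u v w) : s.1 ≠ .d :=
  fst_ne_of_forall_tail (fun h hs x hx hxd =>
    word_notMem_subgroupABC h.reduced_tail le_rfl ⟨x, hx, hxd⟩
      (h.word_tail_mem (gen_mem_subgroupABC hs))) h

theorem tail_fst_ne_d (h : IsPentagon s t u v w) : ∀ x ∈ [t, u, v, w], x.1 ≠ .d := by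
  simp [h.rotate.fst_ne_d, h.rotate.rotate.fst_ne_d, h.rotate.rotate.rotate.fst_ne_d,
    h.rotate.rotate.rotate.rotate.fst_ne_d]

theorem fst_ne_c (h : IsPentagon s t u v w) : s.1 ≠ .c :=
  fst_ne_of_forall_tail (fun {s} _ _ _ _ h hs x hx hxc =>
    word_notMem_subgroupAB h.reduced_tail le_rfl h.tail_fst_ne_d ⟨x, hx, hxc⟩
      (h.word_tail_mem (gen_mem_subgroupAB (by
        have := h.fst_ne_d
        cases hs' : s.1 <;> simp_all)))) h

theorem fst_eq_a_or_b (h : IsPentagon s t u v w) : s.1 = .a ∨ s.1 = .b := by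
  have := h.fst_ne_c
  have := h.fst_ne_d
  cases hs : s.1 <;> simp_all

end IsPentagon

/-- The contribution of a signed letter to the exponent sum of `a`. -/
def signA : Letter × Bool → ℤ
  | (.a, e) => sign e
  | _ => 0

theorem abs_signA_le (s : Letter × Bool) : |signA s| ≤ 1 := by
  obtain ⟨_ | _ | _ | _, e⟩ := s <;> simp [signA, abs_sign]

theorem sign_mul_signA_nonneg {e : Bool} (h : s.1 = .a → s.2 = e) : 0 ≤ sign e * signA s := by
  obtain ⟨_ | _ | _ | _, f⟩ := s
  · obtain rfl := h rfl
    exact mul_self_nonneg _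
  all_goals simp [signA]

theorem exists_ofBS_a_eq_word {L : List (Letter × Bool)} (hL : ∀ s ∈ L, s.1 = .a ∨ s.1 = .b) :
    ∃ g, ofBS .a g = word L ∧ (BS.expX _ g).toAdd = (L.map signA).sum := by
  induction L with
  | nil => exact ⟨1, map_one _, by simp⟩
  | cons s L ih =>
    obtain ⟨g, hg, hexp⟩ := ih fun t ht => hL t (List.mem_cons_of_mem s ht)
    obtain ⟨ℓ, e⟩ := s
    obtain rfl | rfl : ℓ = .a ∨ ℓ = .b := hL _ List.mem_cons_self
    · refine ⟨BS.x _ ^ sign e * g, by simp [hg], ?_⟩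
      simp [hexp, signA]
    · refine ⟨BS.y _ ^ sign e * g, by simp [hg, Letter.next], ?_⟩
      simp [hexp, signA]

theorem sum_signA_eq_zero {L : List (Letter × Bool)} (hL : ∀ s ∈ L, s.1 = .a ∨ s.1 = .b)
    (h : word L = 1) : (L.map signA).sum = 0 := by
  obtain ⟨g, hg, hexp⟩ := exists_ofBS_a_eq_word hL
  rw [h, ← map_one (ofBS .a)] at hg
  rw [ofBS_injective _ hg, map_one] at hexp
  exact hexp.symm

/-- Two consecutive letters `a` of the same sign contribute `±2` to the exponent sum of `a`, and
only the fourth of the five letters can contribute with the opposite sign. -/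
theorem IsPentagon.fst_eq_b_of_fst_eq_a (h : IsPentagon s t u v w) (hs : s.1 = .a) :
    t.1 = .b := by
  refine h.rotate.fst_eq_a_or_b.resolve_left fun ht => ?_
  have hsum := sum_signA_eq_zero (L := [s, t, u, v, w]) (by
    simp [h.fst_eq_a_or_b, h.rotate.fst_eq_a_or_b, h.rotate.rotate.fst_eq_a_or_b,
      h.rotate.rotate.rotate.fst_eq_a_or_b, h.rotate.rotate.rotate.rotate.fst_eq_a_or_b])
    h.word_eq_one
  have hred := h.reduced
  simp only [FreeGroup.isReduced_cons_cons, IsReduced.singleton, and_true] at hred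
  obtain ⟨hst, htu, -, -, hws⟩ := hred
  obtain ⟨_, e⟩ := s
  obtain rfl := hs
  obtain rfl : t = (.a, e) := Prod.ext ht (hst ht.symm).symm
  have hu := sign_mul_signA_nonneg (s := u) (e := e) fun hu => (htu hu.symm).symm
  have hw := sign_mul_signA_nonneg (s := w) (e := e) fun hw => hws hw
  have hv := abs_le.1 (abs_signA_le v)
  have ha : signA (.a, e) = sign e := rfl
  simp only [List.map_cons, List.map_nil, List.sum_cons, List.sum_nil, ha] at hsum
  cases e <;> simp only [sign, cond_true, cond_false] at hsum hu hw <;> omega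

theorem fst_eq_c_of_word_eq_one {e f : Bool} (hs : s.1 = .c ∨ s.1 = .d) (ht : t.1 = .c ∨ t.1 = .d)
    (hu : u.1 = .c ∨ u.1 = .d) (htu : IsReduced [t, u])
    (h : word [(.b, e), (.b, e), s, (.b, f), (.b, f), t, u] = 1) : s.1 = .c := by
  refine hs.resolve_right fun hsd => ?_
  have gen_b_mem : gen .b ∈ subgroupABC := gen_mem_subgroupABC (by simp)
  have mem_CDA {ℓ : Letter} (hℓ : ℓ = .c ∨ ℓ = .d) : gen ℓ ∈ subgroupCDA :=
    gen_mem_subgroupCDA (by rcases hℓ with rfl | rfl <;> simp)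
  have notMem_of_d : word [s] ∉ subgroupABC :=
    word_notMem_subgroupABC .singleton (by simp) ⟨s, by simp, hsd⟩
  have tail_mem : word [s] * word [(.b, f), (.b, f)] * word [t, u] ∈ subgroupABC := by
    refine (subgroupABC.mul_mem_cancel_left (x := word [(.b, e), (.b, e)])
      (word_mem (by simp [gen_b_mem]))).1 ?_
    rw [← word_append, ← word_append, ← word_append]
    exact h ▸ one_mem _
  by_cases htud : ∃ x ∈ [t, u], x.1 = .d
  · refine mul_mul_notMem_subgroupABC (word_mem (by simp [mem_CDA hs])) notMem_of_d
      (word_mem (by simp [gen_b_mem])) ?_ (word_mem (by simp [mem_CDA ht, mem_CDA hu]))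
      (word_notMem_subgroupABC htu (by simp) htud) tail_mem
    exact word_notMem_subgroupCDA (by simp) (by simp) ⟨(.b, f), by simp, rfl⟩
  · push Not at htud
    rw [subgroupABC.mul_mem_cancel_right (word_mem fun x hx => gen_mem_subgroupABC (htud x hx)),
      subgroupABC.mul_mem_cancel_right (word_mem (by simp [gen_b_mem]))] at tail_mem
    exact notMem_of_d tail_mem

end Pentagon

/-- The relator of the relation between `ℓ` and its successor. -/
def relator (ℓ : Letter) : List (Letter × Bool) :=
  List.replicate ℓ.exponent (ℓ, false) ++ (ℓ.next, true) ::
    (List.replicate ℓ.exponent (ℓ, true) ++ [(ℓ.next, false), (ℓ.next, false)])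

theorem word_relator (ℓ : Letter) : word (relator ℓ) = 1 := by
  have h := gen_rel ℓ
  rw [← mul_inv_eq_one] at h
  simpa [relator, sign, pow_two, mul_assoc] using h

theorem eq_false_of_word_eq_one {ℓ : Letter} {e f g i : Bool}
    (h : word (List.replicate ℓ.exponent (ℓ, e) ++ (ℓ.next, f) ::
      (List.replicate ℓ.exponent (ℓ, g) ++ [(ℓ.next, i), (ℓ.next, i)])) = 1) : e = false := by
  have hBS : BS.x ℓ.exponent ^ (sign e * ℓ.exponent) * BS.y _ ^ sign f *
      BS.x _ ^ (sign g * ℓ.exponent) = BS.y _ ^ (-(2 * sign i)) := by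
    apply ofBS_injective ℓ
    simp only [word_append, word_replicate, word_cons, word_nil, mul_one] at h
    simp only [map_mul, zpow_neg, map_inv, map_zpow, ofBS_x, ofBS_y]
    rw [eq_inv_iff_mul_eq_one, ← h, two_mul, zpow_add]
    simp only [mul_assoc]
  have hroot := BS.root_zpow_mul_eq_of_conj ℓ.exponent_ne_zero hBS
  rw [mul_comm (sign e), zpow_mul, zpow_natCast, BS.root_pow ℓ.exponent_ne_zero] at hroot
  cases e
  · rfl
  · cases f <;> cases i <;> norm_num [sign] at hroot

/-! ### Automorphisms of the Cayley graph -/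

theorem gen_zpow_sign_injective :
    Function.Injective fun s : Letter × Bool => gen s.1 ^ sign s.2 := by
  intro s t h
  by_contra hne
  have hred : IsReduced [s, (t.1, !t.2)] := by
    rw [FreeGroup.isReduced_cons_cons]
    refine ⟨fun hfst => ?_, .singleton⟩
    by_contra hsnd
    exact hne (Prod.ext hfst (by simpa using hsnd))
  refine word_ne_one hred (by simp) (by simp) ?_
  simp only at h
  rw [word_cons, h, word_cons, sign_not, word_nil, mul_one, zpow_neg, mul_inv_cancel]

theorem gen_zpow_sign_ne_one (s : Letter × Bool) : gen s.1 ^ sign s.2 ≠ 1 := fun h =>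
  sign_ne_zero _ (gen_zpow_eq_one h)

theorem gen_zpow_sign_mem_generators (s : Letter × Bool) : gen s.1 ^ sign s.2 ∈ generators := by
  obtain ⟨ℓ, _ | _⟩ := s
  · exact ⟨ℓ, .inr (zpow_neg_one _)⟩
  · exact ⟨ℓ, .inl (zpow_one _)⟩

theorem exists_eq_gen_zpow_sign {g : Group'} (hg : g ∈ generators) :
    ∃ s : Letter × Bool, g = gen s.1 ^ sign s.2 := by
  obtain ⟨ℓ, rfl | rfl⟩ := hg
  · exact ⟨(ℓ, true), (zpow_one _).symm⟩
  · exact ⟨(ℓ, false), (zpow_neg_one _).symm⟩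

theorem cayleyGraph_adj_iff {x y : Group'} :
    cayleyGraph.Adj x y ↔ ∃ s : Letter × Bool, y = x * gen s.1 ^ sign s.2 := by
  rw [SimpleGraph.mulCayley_adj']
  constructor
  · rintro ⟨-, g, hg, rfl | rfl⟩ <;> obtain ⟨s, rfl⟩ := exists_eq_gen_zpow_sign hg
    · exact ⟨s, rfl⟩
    · exact ⟨(s.1, !s.2), by rw [sign_not, zpow_neg, mul_inv_cancel_right]⟩
  · rintro ⟨s, rfl⟩
    exact ⟨fun h => gen_zpow_sign_ne_one s (left_eq_mul.1 h), _,
      gen_zpow_sign_mem_generators s, .inl rfl⟩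

section Labels

variable (η : cayleyGraph ≃g cayleyGraph)

theorem exists_label (x : Group') (s : Letter × Bool) :
    ∃ t : Letter × Bool, η (x * gen s.1 ^ sign s.2) = η x * gen t.1 ^ sign t.2 :=
  cayleyGraph_adj_iff.1 (η.map_adj_iff.2 (cayleyGraph_adj_iff.2 ⟨s, rfl⟩))

/-- The label of the image under `η` of the edge with label `s` that starts at `x`. -/
noncomputable def label (x : Group') (s : Letter × Bool) : Letter × Bool :=
  (exists_label η x s).choose

theorem map_mul_gen_zpow_sign (x : Group') (s : Letter × Bool) :
    η (x * gen s.1 ^ sign s.2) = η x * gen (label η x s).1 ^ sign (label η x s).2 :=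
  (exists_label η x s).choose_spec

theorem label_injective (x : Group') : Function.Injective (label η x) := by
  intro s t h
  have := map_mul_gen_zpow_sign η x s
  rw [h, ← map_mul_gen_zpow_sign] at this
  exact gen_zpow_sign_injective (mul_left_cancel (η.injective this))

theorem label_inv (x : Group') (s : Letter × Bool) :
    label η (x * gen s.1 ^ sign s.2) (s.1, !s.2) = ((label η x s).1, !(label η x s).2) := by
  apply gen_zpow_sign_injective
  have h := map_mul_gen_zpow_sign η (x * gen s.1 ^ sign s.2) (s.1, !s.2)
  rw [sign_not, zpow_neg, mul_inv_cancel_right, map_mul_gen_zpow_sign, mul_assoc, left_eq_mul] at h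
  simp only [sign_not, zpow_neg]
  exact eq_inv_of_mul_eq_one_right h

theorem snd_label_eq {x : Group'} {s t : Letter × Bool} (h : s.1 = t.1 → s.2 = t.2) :
    (label η x s).1 = (label η (x * gen s.1 ^ sign s.2) t).1 →
      (label η x s).2 = (label η (x * gen s.1 ^ sign s.2) t).2 := by
  intro hfst
  by_contra hsnd
  have hback : label η (x * gen s.1 ^ sign s.2) t = label η (x * gen s.1 ^ sign s.2) (s.1, !s.2) :=
    by rw [label_inv]; exact Prod.ext hfst.symm (Bool.eq_not.2 (Ne.symm hsnd))
  obtain rfl := label_injective η _ hback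
  simp at h

/-- The labels of the image under `η` of the path with labels `L` that starts at `x`. -/
noncomputable def labels : Group' → List (Letter × Bool) → List (Letter × Bool)
  | _, [] => []
  | x, s :: L => label η x s :: labels (x * gen s.1 ^ sign s.2) L

theorem map_mul_word (x : Group') (L : List (Letter × Bool)) :
    η (x * word L) = η x * word (labels η x L) := by
  induction L generalizing x with
  | nil => simp [labels]
  | cons s L ih =>
    rw [word_cons, ← mul_assoc, ih, map_mul_gen_zpow_sign, labels, word_cons, mul_assoc]

theorem word_labels_eq_one (x : Group') {L : List (Letter × Bool)} (h : word L = 1) :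
    word (labels η x L) = 1 := by
  have := map_mul_word η x L
  rwa [h, mul_one, left_eq_mul] at this

theorem labels_append (x : Group') (L M : List (Letter × Bool)) :
    labels η x (L ++ M) = labels η x L ++ labels η (x * word L) M := by
  induction L generalizing x with
  | nil => simp [labels]
  | cons s L ih => simp [labels, ih, mul_assoc]

theorem isReduced_labels (x : Group') {L : List (Letter × Bool)} (h : IsReduced L) :
    IsReduced (labels η x L) := by
  match L, h with
  | [], _ => exact .nil
  | [s], _ => exact .singleton
  | s :: t :: L, h =>
    rw [FreeGroup.isReduced_cons_cons] at h
    exact FreeGroup.isReduced_cons_cons.2 ⟨snd_label_eq η h.1, isReduced_labels _ h.2⟩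

theorem IsPentagon.map {s t u v w : Letter × Bool} (h : IsPentagon s t u v w) (x : Group') :
    ∃ u' v' w', IsPentagon (label η x s) (label η (x * gen s.1 ^ sign s.2) t) u' v' w' := by
  have hred := isReduced_labels η x h.reduced
  have hlast : labels η x [s, t, u, v, w, s] = labels η x [s, t, u, v, w] ++ [label η x s] := by
    rw [show [s, t, u, v, w, s] = [s, t, u, v, w] ++ [s] from rfl, labels_append, h.word_eq_one,
      mul_one]
    rfl
  rw [hlast] at hred
  exact ⟨_, _, _, hred, word_labels_eq_one η x h.word_eq_one⟩

end Labels

/-- The path that consists of the edges `p` and `q`, both starting at the same vertex, is contained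
in a pentagon. -/
def Corner (p q : Letter × Bool) : Prop := ∃ u v w, IsPentagon (p.1, !p.2) q u v w

namespace Corner

variable {p q : Letter × Bool}

theorem map (h : Corner p q) (η : cayleyGraph ≃g cayleyGraph) (y : Group') :
    Corner (label η y p) (label η y q) := by
  obtain ⟨u, v, w, h⟩ := h
  have := h.map η (y * gen p.1 ^ sign p.2)
  rwa [label_inv, sign_not, zpow_neg, mul_inv_cancel_right] at this

theorem snd_fst_eq_a_or_b (h : Corner p q) : q.1 = .a ∨ q.1 = .b := by
  obtain ⟨u, v, w, h⟩ := h
  exact h.rotate.fst_eq_a_or_b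

theorem fst_fst_eq_b_of_snd_fst_eq_a (h : Corner p q) (hq : q.1 = .a) : p.1 = .b := by
  obtain ⟨u, v, w, h⟩ := h
  refine h.fst_eq_a_or_b.resolve_left fun hp => ?_
  have := h.fst_eq_b_of_fst_eq_a hp
  rw [hq] at this
  cases this

end Corner

theorem isPentagon_relator (e : Bool) :
    IsPentagon (.a, false) (.b, e) (.a, true) (.b, !e) (.b, !e) where
  reduced := by simp
  word_eq_one := by
    cases e
    · have h : (gen .a ^ 1)⁻¹ * gen .b * gen .a ^ 1 = gen .b ^ 2 := gen_rel .a
      simp only [word_cons, word_nil, mul_one, sign, cond_true, cond_false, Bool.not_false,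
        zpow_one, ← pow_two, ← h]
      group
    · exact word_relator .a

theorem corner_a_b (f e : Bool) : Corner (.a, f) (.b, e) := by
  cases f
  · have := (isPentagon_relator (!e)).rotate.rotate
    simp only [Bool.not_not] at this
    exact ⟨_, _, _, this⟩
  · exact ⟨_, _, _, isPentagon_relator e⟩

theorem corner_b_b (e : Bool) : Corner (.b, !e) (.b, e) := by
  have := (isPentagon_relator (!e)).rotate.rotate.rotate
  rw [Bool.not_not] at this
  exact ⟨_, _, _, by rwa [Bool.not_not]⟩

theorem corner_b_a (f : Bool) : Corner (.b, true) (.a, f) := by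
  cases f
  · exact ⟨_, _, _, (isPentagon_relator true).rotate.rotate.rotate.rotate⟩
  · exact ⟨_, _, _, (isPentagon_relator false).rotate⟩

section Rigidity

variable (η : cayleyGraph ≃g cayleyGraph)

theorem eq_of_fst_eq_of_ne {p q r : Letter × Bool} {ℓ : Letter} (hp : p.1 = ℓ)
    (hq : q.1 = ℓ) (hr : r.1 = ℓ) (hpq : p ≠ q) (hpr : p ≠ r) : q = r := by
  obtain ⟨_, e⟩ := p
  obtain ⟨_, f⟩ := q
  obtain ⟨_, g⟩ := r
  obtain rfl := hp
  obtain rfl := hq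
  obtain rfl := hr
  cases e <;> cases f <;> cases g <;> simp_all

/-- Otherwise the three edges `a`, `a⁻¹`, `b^∓1`, each of which forms a corner with `b^±1`, would
be mapped to edges with letter `b`, of which there are only two at a vertex. -/
theorem fst_label_b (x : Group') (e : Bool) : (label η x (.b, e)).1 = .b := by
  refine ((corner_a_b true e).map η x).snd_fst_eq_a_or_b.resolve_left fun ha => ?_
  have fst_eq_b {p : Letter × Bool} (hp : Corner p (.b, e)) : (label η x p).1 = .b :=
    (hp.map η x).fst_fst_eq_b_of_snd_fst_eq_a ha
  have := label_injective η x (eq_of_fst_eq_of_ne (fst_eq_b (corner_b_b e))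
    (fst_eq_b (corner_a_b true e)) (fst_eq_b (corner_a_b false e))
    ((label_injective η x).ne (by simp)) ((label_injective η x).ne (by simp)))
  simp at this

theorem fst_label_ne {ℓ : Letter} {x : Group'} (hℓ : ∀ e, (label η x (ℓ, e)).1 = ℓ)
    {s : Letter × Bool} (hs : s.1 ≠ ℓ) : (label η x s).1 ≠ ℓ := fun h => by
  have := label_injective η x (eq_of_fst_eq_of_ne h (hℓ true) (hℓ false)
    ((label_injective η x).ne fun h => hs (by rw [h]))
    ((label_injective η x).ne fun h => hs (by rw [h])))
  simp at this

theorem fst_label_a (x : Group') (e : Bool) : (label η x (.a, e)).1 = .a :=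
  ((corner_b_a e).map η x).snd_fst_eq_a_or_b.resolve_right
    (fst_label_ne η (fst_label_b η x) (by simp))

theorem fst_label_eq_c_or_d (x : Group') {s : Letter × Bool} (hs : s.1 = .c ∨ s.1 = .d) :
    (label η x s).1 = .c ∨ (label η x s).1 = .d := by
  have ha := fst_label_ne η (fst_label_a η x) (s := s) (by rcases hs with hs | hs <;> simp [hs])
  have hb := fst_label_ne η (fst_label_b η x) (s := s) (by rcases hs with hs | hs <;> simp [hs])
  cases h : (label η x s).1 <;> simp_all

section Replicate

variable {ℓ : Letter} (hℓ : ∀ x e, (label η x (ℓ, e)).1 = ℓ)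
include hℓ

theorem label_mul_self (x : Group') (e : Bool) :
    label η (x * gen ℓ ^ sign e) (ℓ, e) = label η x (ℓ, e) := by
  have hfst : (label η x (ℓ, e)).1 = (label η (x * gen ℓ ^ sign e) (ℓ, e)).1 := by rw [hℓ, hℓ]
  exact (Prod.ext hfst (snd_label_eq η (fun _ => rfl) hfst)).symm

theorem labels_replicate (k : ℕ) (x : Group') (e : Bool) :
    labels η x (List.replicate k (ℓ, e)) = List.replicate k (label η x (ℓ, e)) := by
  induction k generalizing x with
  | zero => rfl
  | succ k ih =>
    rw [List.replicate_succ, labels, ih, label_mul_self η hℓ, List.replicate_succ]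

theorem exists_label_eq (x : Group') (e : Bool) : ∃ f, label η x (ℓ, e) = (ℓ, f) :=
  ⟨_, Prod.ext (hℓ x e) rfl⟩

end Replicate

theorem fst_label_c_true (x : Group') : (label η x (.c, true)).1 = .c := by
  set y := x * (word (List.replicate 2 (.b, false)))⁻¹ with hy
  have h := word_labels_eq_one η y (word_relator .b)
  obtain ⟨e, he⟩ := exists_label_eq η (fst_label_b η) y false
  obtain ⟨f, hf⟩ := exists_label_eq η (fst_label_b η) (x * gen .c ^ sign true) true
  rw [relator, Letter.exponent, Letter.next, labels_append, labels_replicate η (fst_label_b η), he,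
    hy, inv_mul_cancel_right, labels, labels_append, labels_replicate η (fst_label_b η), hf] at h
  have tail_reduced := isReduced_labels η
    (x * gen .c ^ sign true * word (List.replicate 2 (.b, true)))
    (L := [(.c, false), (.c, false)]) (by simp)
  exact fst_eq_c_of_word_eq_one (fst_label_eq_c_or_d η _ (.inl rfl))
    (fst_label_eq_c_or_d η _ (.inl rfl)) (fst_label_eq_c_or_d η _ (.inl rfl)) tail_reduced h

theorem fst_label_c (x : Group') (e : Bool) : (label η x (.c, e)).1 = .c := by
  cases e
  · have h := label_inv η (x * gen .c ^ sign false) (.c, true)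
    have hx : x * gen .c ^ sign false * gen .c ^ sign true = x := by simp [sign]
    rw [hx] at h
    exact (congrArg Prod.fst h).trans (fst_label_c_true η _)
  · exact fst_label_c_true η x

theorem fst_label_d (x : Group') (e : Bool) : (label η x (.d, e)).1 = .d :=
  (fst_label_eq_c_or_d η x (.inr rfl)).resolve_left
    (fst_label_ne η (fst_label_c η x) (by simp))

theorem fst_label_eq (ℓ : Letter) (x : Group') (e : Bool) : (label η x (ℓ, e)).1 = ℓ := by
  cases ℓ
  exacts [fst_label_a η x e, fst_label_b η x e, fst_label_c η x e, fst_label_d η x e]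

theorem label_false (ℓ : Letter) (x : Group') : label η x (ℓ, false) = (ℓ, false) := by
  have h := word_labels_eq_one η x (word_relator ℓ)
  obtain ⟨e, he⟩ := exists_label_eq η (fst_label_eq η ℓ) x false
  rw [relator, labels_append, labels_replicate η (fst_label_eq η ℓ), he, labels, labels_append,
    labels_replicate η (fst_label_eq η ℓ), labels, labels, labels,
    label_mul_self η (fst_label_eq η ℓ.next)] at h
  obtain ⟨f, hf⟩ := exists_label_eq η (fst_label_eq η ℓ.next) (x * word (.replicate _ _)) true
  obtain ⟨g, hg⟩ := exists_label_eq η (fst_label_eq η ℓ) (x * word (.replicate _ _) * _) true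
  obtain ⟨i, hi⟩ := exists_label_eq η (fst_label_eq η ℓ.next)
    (x * word (.replicate _ _) * _ * word (.replicate _ _)) false
  rw [hf, hg, hi] at h
  rw [he, eq_false_of_word_eq_one h]

theorem map_mul_gen (x : Group') (ℓ : Letter) : η (x * gen ℓ) = η x * gen ℓ := by
  have h := map_mul_gen_zpow_sign η (x * gen ℓ) (ℓ, false)
  rw [label_false] at h
  rw [sign, cond_false, zpow_neg_one, mul_inv_cancel_right, eq_mul_inv_iff_mul_eq] at h
  exact h.symm

theorem map_mul_right (x g : Group') : η (x * g) = η x * g := by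
  let K : Subgroup Group' :=
    { carrier := {g | ∀ x, η (x * g) = η x * g}
      one_mem' := fun x => by simp only [mul_one]
      mul_mem' := fun {g h} hg hh x => by rw [← mul_assoc, hh, hg, mul_assoc]
      inv_mem' := fun {g} hg x => by rw [eq_mul_inv_iff_mul_eq, ← hg, inv_mul_cancel_right] }
  exact PresentedGroup.generated_by relators K (fun ℓ x => map_mul_gen η x ℓ) g x

end Rigidity

theorem vertexStabilizer_eq_bot (v : Group') : vertexStabilizer cayleyGraph v = ⊥ := by
  refine (Subgroup.eq_bot_iff_forall _).2 fun η (hη : η v = v) => RelIso.ext fun x => ?_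
  change η x = x
  rw [← mul_inv_cancel_left v x, map_mul_right, hη]

/-! ### Quotients of `Γ'` -/

theorem pow_conj_eq_pow {Q : Type*} [Group Q] {x y : Q} (h : x⁻¹ * y * x = y ^ 2) (n : ℕ) :
    (x ^ n)⁻¹ * y * x ^ n = y ^ 2 ^ n := by
  induction n with
  | zero => simp
  | succ n ih =>
    have conj_pow_inv : x⁻¹ * y ^ 2 ^ n * x = (x⁻¹ * y * x) ^ 2 ^ n := by
      simpa using (conj_pow (i := 2 ^ n) (a := x⁻¹) (b := y)).symm
    calc (x ^ (n + 1))⁻¹ * y * x ^ (n + 1) = x⁻¹ * ((x ^ n)⁻¹ * y * x ^ n) * x := by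
          rw [pow_succ]; group
      _ = y ^ 2 ^ (n + 1) := by rw [ih, conj_pow_inv, h, ← pow_mul, pow_succ']

theorem orderOf_dvd_two_pow_orderOf_sub_one {Q : Type*} [Group Q] {x y : Q} {k : ℕ}
    (h : (x ^ k)⁻¹ * y * x ^ k = y ^ 2) : orderOf y ∣ 2 ^ orderOf x - 1 := by
  have hpow : y ^ 2 ^ orderOf x = y := by
    rw [← pow_conj_eq_pow h, ← pow_mul, mul_comm, pow_mul, pow_orderOf_eq_one, one_pow, inv_one,
      one_mul, mul_one]
  apply orderOf_dvd_of_pow_eq_one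
  rw [pow_sub _ Nat.one_le_two_pow, hpow, pow_one, mul_inv_cancel]

theorem exists_prime_lt_of_dvd_two_pow_sub_one {p n : ℕ} (hp : p.Prime) (hn : n ≠ 0)
    (h : p ∣ 2 ^ n - 1) : ∃ q < p, q.Prime ∧ q ∣ n := by
  have : Fact p.Prime := ⟨hp⟩
  have two_pow_eq_one : (2 : ZMod p) ^ n = 1 := by
    have := (ZMod.natCast_eq_zero_iff _ _).2 h
    rw [Nat.cast_sub Nat.one_le_two_pow] at this
    simpa [sub_eq_zero] using this
  have two_ne_zero : (2 : ZMod p) ≠ 0 := fun h => by simp [h, hn] at two_pow_eq_one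
  have orderOf_ne_one : orderOf (2 : ZMod p) ≠ 1 := fun h => by
    rw [orderOf_eq_one_iff] at h
    exact one_ne_zero (α := ZMod p) (by linear_combination h)
  have sub_one_pos : 0 < p - 1 := Nat.sub_pos_of_lt hp.one_lt
  have orderOf_dvd := ZMod.orderOf_dvd_card_sub_one two_ne_zero
  refine ⟨_, ?_, Nat.minFac_prime orderOf_ne_one,
    (Nat.minFac_dvd _).trans (orderOf_dvd_of_pow_eq_one two_pow_eq_one)⟩
  calc (orderOf (2 : ZMod p)).minFac ≤ orderOf (2 : ZMod p) :=
        Nat.minFac_le (Nat.pos_of_dvd_of_pos orderOf_dvd sub_one_pos)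
    _ ≤ p - 1 := Nat.le_of_dvd sub_one_pos orderOf_dvd
    _ < p := Nat.sub_lt hp.pos one_pos

section Hom

variable {G : Type*} [Group G]

theorem hom_eq_one_of_gen {f : Group' →* G} (h : ∀ ℓ, f (gen ℓ) = 1) : f = 1 :=
  PresentedGroup.ext h

theorem map_gen_rel (f : Group' →* G) (ℓ : Letter) :
    (f (gen ℓ) ^ ℓ.exponent)⁻¹ * f (gen ℓ.next) * f (gen ℓ) ^ ℓ.exponent = f (gen ℓ.next) ^ 2 := by
  simp only [← map_pow, ← map_inv, ← map_mul, gen_rel]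

/-- The smallest prime that divides the order of some generator would yield a smaller one. -/
theorem hom_eq_one_of_finite [Finite G] (f : Group' →* G) : f = 1 := by
  have not_dvd (p : ℕ) : p.Prime → ∀ ℓ, ¬ p ∣ orderOf (f (gen ℓ)) := by
    induction p using Nat.strong_induction_on with
    | _ p ih =>
      intro hp ℓ' hdvd
      obtain ⟨ℓ, rfl⟩ := Letter.next_surjective ℓ'
      obtain ⟨q, hqp, hq, hqdvd⟩ := exists_prime_lt_of_dvd_two_pow_sub_one hp (orderOf_pos _).ne'
        (hdvd.trans (orderOf_dvd_two_pow_orderOf_sub_one (map_gen_rel f ℓ)))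
      exact ih q hqp hq ℓ hqdvd
  refine hom_eq_one_of_gen fun ℓ => ?_
  by_contra hne
  obtain ⟨p, hp, hdvd⟩ := Nat.exists_prime_and_dvd (mt orderOf_eq_one_iff.1 hne)
  exact not_dvd p hp ℓ hdvd

theorem hom_eq_one_of_comm {A : Type*} [CommGroup A] (f : Group' →* A) : f = 1 := by
  refine hom_eq_one_of_gen fun ℓ' => ?_
  obtain ⟨ℓ, rfl⟩ := Letter.next_surjective ℓ'
  have h := map_gen_rel f ℓ
  rwa [mul_comm, mul_inv_cancel_left, pow_two, left_eq_mul] at h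

end Hom

theorem eq_top_of_normal_of_finiteIndex (N : Subgroup Group') [N.Normal] [N.FiniteIndex] :
    N = ⊤ := by
  rw [← QuotientGroup.ker_mk' N, hom_eq_one_of_finite (QuotientGroup.mk' N), MonoidHom.ker_one]

theorem eq_top_of_finiteIndex (N : Subgroup Group') [N.FiniteIndex] : N = ⊤ :=
  top_le_iff.1 (eq_top_of_normal_of_finiteIndex N.normalCore ▸ N.normalCore_le)

theorem eq_zero_of_map_mul {h : Group' → ℤ} (hmul : ∀ x y, h (x * y) = h x + h y) (g : Group') :
    h g = 0 := by
  let f : Group' →* Multiplicative ℤ := MonoidHom.mk' (fun x => .ofAdd (h x)) fun x y => by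
    rw [hmul, ofAdd_add]
  exact Multiplicative.ofAdd.injective (DFunLike.congr_fun (hom_eq_one_of_comm f) g)

/-! ### Height functions -/

theorem exists_list_prod_eq (g : Group') :
    ∃ L : List Group', (∀ s ∈ L, s ∈ generators) ∧ L.prod = g := by
  have hg : g ∈ (Subgroup.closure (Set.range gen)).toSubmonoid :=
    (PresentedGroup.closure_range_of relators).ge (Subgroup.mem_top g)
  rw [Subgroup.closure_toSubmonoid] at hg
  obtain ⟨L, hL, rfl⟩ := Submonoid.exists_list_of_mem_closure hg
  refine ⟨L, fun s hs => ?_, rfl⟩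
  obtain ⟨ℓ, h⟩ | ⟨ℓ, h⟩ := hL s hs
  · exact ⟨ℓ, .inl h.symm⟩
  · exact ⟨ℓ, .inr (inv_eq_iff_eq_inv.1 h.symm)⟩

theorem not_isGroupHeightFunction (h : Group' → ℤ) : ¬ IsGroupHeightFunction generators h := by
  intro hh
  obtain ⟨g, hg⟩ := hh.not_identically_zero
  refine hg (eq_zero_of_map_mul (fun x y => ?_) g)
  obtain ⟨L, hL, rfl⟩ := exists_list_prod_eq x
  obtain ⟨M, hM, rfl⟩ := exists_list_prod_eq y
  rw [← List.prod_append, hh.map_word _ hL, hh.map_word _ hM, hh.map_word, List.map_append,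
    List.sum_append]
  exact fun s hs => (List.mem_append.1 hs).elim (hL s) (hM s)

/-- The action of `Γ'` on its Cayley graph by left multiplication. -/
def leftMul : Group' →* (cayleyGraph ≃g cayleyGraph) where
  toFun g := ⟨Equiv.mulLeft g, SimpleGraph.mulCayley_adj_mul_iff_right⟩
  map_one' := by ext x; exact one_mul x
  map_mul' g h := by ext x; exact mul_assoc g h x

theorem leftMul_apply (g x : Group') : leftMul g x = g * x := rfl

theorem eq_leftMul (η : cayleyGraph ≃g cayleyGraph) : η = leftMul (η 1) := by
  ext x
  rw [leftMul_apply, ← map_mul_right, one_mul]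

theorem leftMul_mem_of_actsQuasiTransitively {H : Subgroup (cayleyGraph ≃g cayleyGraph)}
    (hH : ActsQuasiTransitively cayleyGraph H) (g : Group') : leftMul g ∈ H := by
  obtain ⟨W, hW, hWH⟩ := hH
  let N : Subgroup Group' := H.comap leftMul
  have finite_quotient : Finite (Group' ⧸ N) := by
    have := hW.to_subtype
    refine Finite.of_surjective (fun w : W => (QuotientGroup.mk (w : Group')⁻¹ : Group' ⧸ N)) ?_
    intro q
    obtain ⟨g, rfl⟩ := QuotientGroup.mk_surjective q
    obtain ⟨α, hα, w, hw, h⟩ := hWH g⁻¹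
    rw [eq_leftMul α, leftMul_apply, mul_inv_eq_iff_eq_mul] at h
    rw [eq_leftMul α, h] at hα
    exact ⟨⟨w, hw⟩, QuotientGroup.eq.2 (by rwa [inv_inv])⟩
  have : N.FiniteIndex := Subgroup.finiteIndex_of_finite_quotient
  have mem_N : g ∈ N := eq_top_of_finiteIndex N ▸ Subgroup.mem_top g
  exact mem_N

theorem not_isGraphHeightFunction (h : Group' → ℤ) (H : Subgroup (cayleyGraph ≃g cayleyGraph)) :
    ¬ IsGraphHeightFunction cayleyGraph 1 h H := by
  intro hh
  have hmul (x y : Group') : h (x * y) = h x + h y := by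
    have := hh.differenceInvariant y 1 _ (leftMul_mem_of_actsQuasiTransitively hh.quasiTransitive x)
    rw [leftMul_apply, leftMul_apply, mul_one, hh.map_origin] at this
    linarith
  obtain ⟨u, w, -, -, hlt, -⟩ := hh.exists_lt_lt 1
  rw [eq_zero_of_map_mul hmul, eq_zero_of_map_mul hmul] at hlt
  exact lt_irrefl _ hlt

end HigmanType

/-- The Cayley graph of `Γ'` (with origin the identity) has no graph height function; moreover `Γ'`
has no group height function, the vertex stabilizers in the automorphism group of its Cayley graph
are trivial, and `Γ'` has no proper normal subgroup of finite index. -/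
theorem mainTheorem6 :
    (¬ ∃ (h : HigmanType.Group' → ℤ)
        (H : Subgroup (HigmanType.cayleyGraph ≃g HigmanType.cayleyGraph)),
        HigmanType.IsGraphHeightFunction HigmanType.cayleyGraph 1 h H) ∧
      (¬ ∃ h : HigmanType.Group' → ℤ,
        HigmanType.IsGroupHeightFunction HigmanType.generators h) ∧
      (∀ v : HigmanType.Group', HigmanType.vertexStabilizer HigmanType.cayleyGraph v = ⊥) ∧
      (¬ ∃ N : Subgroup HigmanType.Group', N.Normal ∧ N.FiniteIndex ∧ N ≠ ⊤) := by
  refine ⟨?_, ?_, HigmanType.vertexStabilizer_eq_bot, ?_⟩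
  · rintro ⟨h, H, hh⟩
    exact HigmanType.not_isGraphHeightFunction h H hh
  · rintro ⟨h, hh⟩
    exact HigmanType.not_isGroupHeightFunction h hh
  · rintro ⟨N, hN, hfin, hne⟩
    exact hne (HigmanType.eq_top_of_normal_of_finiteIndex N)
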